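/- **Notation.** Let $Ring$ be the category of (not necessarily commutative) unital rings, with the monoidal structure given by $\otimes_{\mathbb Z}$ and unit $\mathbb Z$. Let $Cat(Ab)$ be the category of small $Ab$-enriched (preadditive) categories and additive functors, with the monoidal structure in which $\mathcal C\otimes\mathcal D$ has as objects the pairs $(c,d)$ and as morphism groups $\mathcal C(c,c')\otimes_{\mathbb Z}\mathcal D(d,d')$; its unit is the one-object category with endomorphism ring $\mathbb Z$, and it is closed, the internal hom $[\mathcal C,\mathcal D]$ being the preadditive category of additive functors and natural transformations. For a ring $M$ let $\underline M\in Cat(Ab)$ be the one-object category with endomorphism ring $M$, composition being multiplication; this gives a functor $\underline{(-)}:Ring\to Cat(Ab)$. Let $\underline{Ring}\subseteq Cat(Ab)$ be the full subcategory on all objects isomorphic to some $\underline M$. It contains the unit and is closed under $\otimes$, so it is a monoidal category, and it is a full $Cat(Ab)$-enriched subcategory of $Cat(Ab)$ enriched over itself. For a commutative unital ring $R$, the multiplication and unit of $R$ make $R$ a monoid in $Ring$ and $\underline R$ a monoid in $Cat(Ab)$ and in $\underline{Ring}$. Let $\underline{\underline R}$ be the one-object category enriched in $Cat(Ab)$ (and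 also in $\underline{Ring}$) with hom-object $\underline R$ and composition the multiplication $\underline R\otimes\underline R\to\underline R$. For a monoid $A$ in a monoidal category $\mathcal W$, $\mathrm{LMod}_A(\mathcal W)$ is the category of left $A$-modules in $\mathcal W$ and $A$-linear morphisms. $Fun^{Cat(Ab)}(\underline{\underline R},\underline{Ring})$ is the category of $Cat(Ab)$-enriched functors and $Cat(Ab)$-enriched natural transformations. $Fun^{\underline{Ring}}(\underline{\underline R},\underline{Ring})$ is the category of $\underline{Ring}$-enriched functors from $\underline{\underline R}$ to the base $\underline{Ring}$ itself and their enriched natural transformations. Since $\underline{Ring}$ is not closed, these are understood through transposes: a functor $F$ is an object $F(*)$ of $\underline{Ring}$ with a morphism $F(*)\otimes\underline R\to F(*)$ in $\underline{Ring}$ compatible with the identity and the composition of $\underline{\underline R}$, and a transformation $F\Rightarrow G$ is a morphism $F(*)\to G(*)$ in $\underline{Ring}$ commuting with these structure morphisms. **Theorem.** For every commutative unital ring $R$ there is a chain of equivalences of categories $$\mathrm{LMod}_R(Ring)\;\simeq\;\mathrm{LMod}_{\underline R}(\underline{Ring})\;\simeq\;Fun^{Cat(Ab)}(\underline{\underline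 R},\underline{Ring})\;\simeq\;Fun^{\underline{Ring}}(\underline{\underline R},\underline{Ring}).$$ -/

import Mathlib

open CategoryTheory MonoidalCategory
open scoped TensorProduct

universe u v w

namespace RingCat

theorem tensor_ringHom_ext {A B C : Type*} [Ring A] [Ring B] [Ring C]
    {f g : A ⊗[ℤ] B →+* C} (h : ∀ a b, f (a ⊗ₜ b) = g (a ⊗ₜ b)) : f = g := by
  refine RingHom.ext fun x ↦ ?_
  induction x using TensorProduct.induction_on with
  | zero => simp
  | tmul a b => exact h a b
  | add x y hx hy => simp only [map_add, hx, hy]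

/-- The tensor product over `ℤ` of two ring homomorphisms. -/
noncomputable def tensorRingHom {A B C D : Type*} [Ring A] [Ring B] [Ring C] [Ring D]
    (f : A →+* B) (g : C →+* D) : A ⊗[ℤ] C →+* B ⊗[ℤ] D :=
  (Algebra.TensorProduct.map f.toIntAlgHom g.toIntAlgHom).toRingHom

@[simp]
theorem tensorRingHom_tmul {A B C D : Type*} [Ring A] [Ring B] [Ring C] [Ring D]
    (f : A →+* B) (g : C →+* D) (a : A) (c : C) :
    tensorRingHom f g (a ⊗ₜ c) = f a ⊗ₜ g c := rfl

/-- `ℤ` (in universe `u`) is a left unit for the tensor product of rings. -/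
noncomputable def tensorLid (A : Type u) [Ring A] : ULift.{u} ℤ ⊗[ℤ] A ≃+* A :=
  ((Algebra.TensorProduct.congr
      (AlgEquiv.ofRingEquiv (R := ℤ) (f := (ULift.ringEquiv : ULift.{u} ℤ ≃+* ℤ)) (by simp))
      (AlgEquiv.refl : A ≃ₐ[ℤ] A)).trans (Algebra.TensorProduct.lid ℤ A)).toRingEquiv

/-- `ℤ` (in universe `u`) is a right unit for the tensor product of rings. -/
noncomputable def tensorRid (A : Type u) [Ring A] : A ⊗[ℤ] ULift.{u} ℤ ≃+* A :=
  ((Algebra.TensorProduct.congr (AlgEquiv.refl : A ≃ₐ[ℤ] A)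
      (AlgEquiv.ofRingEquiv (R := ℤ) (f := (ULift.ringEquiv : ULift.{u} ℤ ≃+* ℤ))
        (by simp))).trans (Algebra.TensorProduct.rid ℤ ℤ A)).toRingEquiv

@[simp]
theorem tensorLid_tmul (A : Type u) [Ring A] (n : ULift.{u} ℤ) (a : A) :
    tensorLid A (n ⊗ₜ a) = n.down • a := rfl

@[simp]
theorem tensorRid_tmul (A : Type u) [Ring A] (n : ULift.{u} ℤ) (a : A) :
    tensorRid A (a ⊗ₜ n) = n.down • a := rfl

/-- The tensor product of rings over `ℤ`, with unit `ℤ`. -/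
noncomputable instance instMonoidalCategoryStruct : MonoidalCategoryStruct RingCat.{u} where
  tensorObj A B := RingCat.of (A ⊗[ℤ] B)
  whiskerLeft A _ _ f := RingCat.ofHom (tensorRingHom (RingHom.id A) f.hom)
  whiskerRight f B := RingCat.ofHom (tensorRingHom f.hom (RingHom.id B))
  tensorHom f g := RingCat.ofHom (tensorRingHom f.hom g.hom)
  tensorUnit := RingCat.of (ULift.{u} ℤ)
  associator A B C := (Algebra.TensorProduct.assoc ℤ ℤ ℤ A B C).toRingEquiv.toRingCatIso
  leftUnitor A := (tensorLid A).toRingCatIso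
  rightUnitor A := (tensorRid A).toRingCatIso

theorem tensor_hom_ext {A B C : RingCat.{u}} {f g : A ⊗ B ⟶ C}
    (h : ∀ (a : A) (b : B), f.hom (a ⊗ₜ[ℤ] b) = g.hom (a ⊗ₜ[ℤ] b)) : f = g :=
  RingCat.hom_ext (tensor_ringHom_ext h)

theorem tensor_hom_ext₃ {A B C D : RingCat.{u}} {f g : (A ⊗ B) ⊗ C ⟶ D}
    (h : ∀ (a : A) (b : B) (c : C),
      f.hom ((a ⊗ₜ[ℤ] b) ⊗ₜ[ℤ] c) = g.hom ((a ⊗ₜ[ℤ] b) ⊗ₜ[ℤ] c)) : f = g := by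
  refine tensor_hom_ext fun x c ↦ ?_
  change A ⊗[ℤ] B at x
  induction x using TensorProduct.induction_on with
  | zero => rw [TensorProduct.zero_tmul]; exact (map_zero f.hom).trans (map_zero g.hom).symm
  | tmul a b => exact h a b c
  | add x y hx hy =>
    rw [TensorProduct.add_tmul]
    exact (map_add f.hom _ _).trans ((congrArg₂ (· + ·) hx hy).trans (map_add g.hom _ _).symm)

theorem tensor_hom_ext₄ {A B C D E : RingCat.{u}} {f g : ((A ⊗ B) ⊗ C) ⊗ D ⟶ E}
    (h : ∀ (a : A) (b : B) (c : C) (d : D),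
      f.hom (((a ⊗ₜ[ℤ] b) ⊗ₜ[ℤ] c) ⊗ₜ[ℤ] d) = g.hom (((a ⊗ₜ[ℤ] b) ⊗ₜ[ℤ] c) ⊗ₜ[ℤ] d)) :
    f = g := by
  refine tensor_hom_ext₃ fun x c d ↦ ?_
  change A ⊗[ℤ] B at x
  induction x using TensorProduct.induction_on with
  | zero =>
    rw [TensorProduct.zero_tmul, TensorProduct.zero_tmul]
    exact (map_zero f.hom).trans (map_zero g.hom).symm
  | tmul a b => exact h a b c d
  | add x y hx hy =>
    rw [TensorProduct.add_tmul, TensorProduct.add_tmul]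
    exact (map_add f.hom _ _).trans ((congrArg₂ (· + ·) hx hy).trans (map_add g.hom _ _).symm)

noncomputable instance instMonoidalCategory : MonoidalCategory RingCat.{u} :=
  MonoidalCategory.ofTensorHom
    (id_tensorHom_id := fun _ _ ↦ tensor_hom_ext fun _ _ ↦ rfl)
    (id_tensorHom := fun _ _ _ _ ↦ rfl)
    (tensorHom_id := fun _ _ ↦ rfl)
    (tensorHom_comp_tensorHom := fun _ _ _ _ ↦ tensor_hom_ext fun _ _ ↦ rfl)
    (associator_naturality := fun _ _ _ ↦ tensor_hom_ext₃ fun _ _ _ ↦ rfl)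
    (leftUnitor_naturality := fun f ↦ tensor_hom_ext fun n a ↦
      (map_zsmul f.hom n.down a).symm)
    (rightUnitor_naturality := fun f ↦ tensor_hom_ext fun a n ↦
      (map_zsmul f.hom n.down a).symm)
    (pentagon := fun _ _ _ _ ↦ tensor_hom_ext₄ fun _ _ _ _ ↦ rfl)
    (triangle := fun _ _ ↦ tensor_hom_ext₃ fun a n b ↦
      (TensorProduct.smul_tmul n.down a b).symm)

/-- A commutative ring is a monoid in the monoidal category of rings: its multiplication
`R ⊗ R → R` is a ring homomorphism. -/
noncomputable instance instMonObj (R : Type u) [CommRing R] : MonObj (RingCat.of R) where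
  one := RingCat.ofHom ((Int.castRingHom R).comp (ULift.ringEquiv : ULift.{u} ℤ ≃+* ℤ).toRingHom)
  mul := RingCat.ofHom (Algebra.TensorProduct.lmul' ℤ (S := R)).toRingHom
  one_mul := tensor_hom_ext fun n a ↦ (zsmul_eq_mul a n.down).symm
  mul_one := tensor_hom_ext fun a n ↦ ((zsmul_eq_mul a n.down).trans (mul_comm _ _)).symm
  mul_assoc := tensor_hom_ext₃ fun a b c ↦ mul_assoc (G := R) a b c

end RingCat

/-! ### The category `Cat(Ab)` -/

/-- A small `Ab`-enriched category, i.e. a small preadditive category. -/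
structure CatAb : Type (u + 1) where
  /-- The type of objects. -/
  carrier : Type u
  [category : Category.{u} carrier]
  [preadditive : Preadditive carrier]

namespace CatAb

instance : CoeSort CatAb.{u} (Type u) := ⟨carrier⟩

attribute [instance] category preadditive

/-- Morphisms of `Cat(Ab)` are `Ab`-enriched, i.e. additive, functors; as in the category of
small categories, they are compared up to equality and not up to isomorphism. -/
instance : Category CatAb.{u} where
  Hom C D := C ⥤+ D
  id C := AdditiveFunctor.of (𝟭 C)
  comp F G := AdditiveFunctor.of (F.obj ⋙ G.obj)

/-- The additive functor underlying a morphism of `Cat(Ab)`. -/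
abbrev fn {C D : CatAb.{u}} (F : C ⟶ D) : C ⥤ D := ObjectProperty.FullSubcategory.obj F

instance {C D : CatAb.{u}} (F : C ⟶ D) : (fn F).Additive := F.property

/-- A morphism of `Cat(Ab)` from an additive functor. -/
abbrev ofFun {C D : CatAb.{u}} (F : C ⥤ D) [F.Additive] : C ⟶ D := AdditiveFunctor.of F

theorem hom_ext {C D : CatAb.{u}} {F G : C ⟶ D} (h : fn F = fn G) : F = G :=
  ObjectProperty.FullSubcategory.ext h

/-- Two morphisms of `Cat(Ab)` are equal if they agree on objects and on arrows. -/
theorem hom_hext {C D : CatAb.{u}} {F G : C ⟶ D} (hobj : ∀ X, (fn F).obj X = (fn G).obj X)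
    (hmap : ∀ (X Y : C) (f : X ⟶ Y), HEq ((fn F).map f) ((fn G).map f)) : F = G :=
  hom_ext (Functor.hext hobj hmap)

/-! ### The tensor product of `Ab`-enriched categories -/

/-- Objects of the tensor product of two categories are pairs of objects. -/
structure TensorObj (C D : Type u) : Type u where
  /-- The first component. -/
  fst : C
  /-- The second component. -/
  snd : D

section Tensor

variable {C D : Type u} [Category.{u} C] [Preadditive C] [Category.{u} D] [Preadditive D]

/-- The composition `(f ⊗ g) ≫ (f' ⊗ g') = (f ≫ f') ⊗ (g ≫ g')`, as a bilinear map. -/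
noncomputable def tensorComp (X Y Z : TensorObj C D) :
    ((X.fst ⟶ Y.fst) ⊗[ℤ] (X.snd ⟶ Y.snd)) →ₗ[ℤ] ((Y.fst ⟶ Z.fst) ⊗[ℤ] (Y.snd ⟶ Z.snd)) →ₗ[ℤ]
      ((X.fst ⟶ Z.fst) ⊗[ℤ] (X.snd ⟶ Z.snd)) :=
  TensorProduct.map₂ (Linear.comp (S := ℤ) X.fst Y.fst Z.fst)
    (Linear.comp (S := ℤ) X.snd Y.snd Z.snd)

theorem tensorComp_tmul {X Y Z : TensorObj C D} (f : X.fst ⟶ Y.fst) (g : X.snd ⟶ Y.snd)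
    (f' : Y.fst ⟶ Z.fst) (g' : Y.snd ⟶ Z.snd) :
    tensorComp X Y Z (f ⊗ₜ g) (f' ⊗ₜ g') = (f ≫ f') ⊗ₜ (g ≫ g') := rfl

/-- The group of arrows `(c, d) ⟶ (c', d')` is `C(c, c') ⊗ D(d, d')`. -/
noncomputable instance TensorObj.category : Category.{u} (TensorObj C D) where
  Hom X Y := (X.fst ⟶ Y.fst) ⊗[ℤ] (X.snd ⟶ Y.snd)
  id X := 𝟙 X.fst ⊗ₜ[ℤ] 𝟙 X.snd
  comp {X Y Z} f g := tensorComp X Y Z f g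
  id_comp {X Y} f := by
    induction f using TensorProduct.induction_on with
    | zero => exact map_zero _
    | tmul f g => simp only [tensorComp_tmul, Category.id_comp]
    | add f g hf hg => exact (map_add _ _ _).trans (congrArg₂ (· + ·) hf hg)
  comp_id {X Y} f := by
    induction f using TensorProduct.induction_on with
    | zero => exact LinearMap.map_zero₂ _ _
    | tmul f g => simp only [tensorComp_tmul, Category.comp_id]
    | add f g hf hg => exact (LinearMap.map_add₂ _ _ _ _).trans (congrArg₂ (· + ·) hf hg)
  assoc {W X Y Z} f g h := by
    induction f using TensorProduct.induction_on with
    | zero => simp only [LinearMap.map_zero₂]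
    | add f f' hf hf' => simp only [LinearMap.map_add₂, hf, hf']
    | tmul f f' =>
      induction g using TensorProduct.induction_on with
      | zero => simp only [LinearMap.zero_apply, map_zero]
      | add g g' hg hg' => simp only [LinearMap.add_apply, map_add, hg, hg']
      | tmul g g' =>
        induction h using TensorProduct.induction_on with
        | zero => simp only [map_zero]
        | add h h' hh hh' => simp only [map_add, hh, hh']
        | tmul h h' => simp only [tensorComp_tmul, Category.assoc]

noncomputable instance TensorObj.preadditive : Preadditive (TensorObj C D) where
  homGroup X Y := inferInstanceAs (AddCommGroup ((X.fst ⟶ Y.fst) ⊗[ℤ] (X.snd ⟶ Y.snd)))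
  add_comp X Y Z f f' g := LinearMap.map_add₂ (tensorComp X Y Z) f f' g
  comp_add X Y Z f g g' := LinearMap.map_add (tensorComp X Y Z f) g g'

/-- The arrow `f ⊗ g` of the tensor product. -/
noncomputable def tmul {c c' : C} {d d' : D} (f : c ⟶ c') (g : d ⟶ d') :
    TensorObj.mk c d ⟶ TensorObj.mk c' d' := f ⊗ₜ[ℤ] g

theorem tmul_id (c : C) (d : D) : tmul (𝟙 c) (𝟙 d) = 𝟙 (TensorObj.mk c d) := rfl

theorem tmul_comp {c c' c'' : C} {d d' d'' : D} (f : c ⟶ c') (g : d ⟶ d') (f' : c' ⟶ c'')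
    (g' : d' ⟶ d'') : tmul f g ≫ tmul f' g' = tmul (f ≫ f') (g ≫ g') := rfl

theorem zero_tmul (c c' : C) {d d' : D} (g : d ⟶ d') : tmul (0 : c ⟶ c') g = 0 :=
  TensorProduct.zero_tmul _ g

theorem tmul_zero {c c' : C} (d d' : D) (f : c ⟶ c') : tmul f (0 : d ⟶ d') = 0 :=
  TensorProduct.tmul_zero _ f

theorem add_tmul {c c' : C} {d d' : D} (f f' : c ⟶ c') (g : d ⟶ d') :
    tmul (f + f') g = tmul f g + tmul f' g := TensorProduct.add_tmul f f' g

theorem tmul_add {c c' : C} {d d' : D} (f : c ⟶ c') (g g' : d ⟶ d') :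
    tmul f (g + g') = tmul f g + tmul f g' := TensorProduct.tmul_add f g g'

@[elab_as_elim]
theorem hom_induction {c c' : C} {d d' : D}
    {p : (TensorObj.mk c d ⟶ TensorObj.mk c' d') → Prop}
    (f : TensorObj.mk c d ⟶ TensorObj.mk c' d') (zero : p 0)
    (tmul : ∀ (f : c ⟶ c') (g : d ⟶ d'), p (tmul f g))
    (add : ∀ f g, p f → p g → p (f + g)) : p f :=
  TensorProduct.induction_on (motive := p) f zero tmul (fun x y ↦ add x y)

/-- The additive functor out of a tensor product that is given by its values on objects and by
biadditive maps on arrows which preserve identities and compositions. -/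
noncomputable def TensorObj.lift {E : Type u} [Category.{u} E] [Preadditive E]
    (obj : C → D → E)
    (map : ∀ {c c' : C} {d d' : D}, (c ⟶ c') → (d ⟶ d') → (obj c d ⟶ obj c' d'))
    (add_map : ∀ {c c' : C} {d d' : D} (f f' : c ⟶ c') (g : d ⟶ d'),
      map (f + f') g = map f g + map f' g)
    (map_add : ∀ {c c' : C} {d d' : D} (f : c ⟶ c') (g g' : d ⟶ d'),
      map f (g + g') = map f g + map f g')
    (map_id : ∀ (c : C) (d : D), map (𝟙 c) (𝟙 d) = 𝟙 (obj c d))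
    (map_comp : ∀ {c c' c'' : C} {d d' d'' : D} (f : c ⟶ c') (g : d ⟶ d') (f' : c' ⟶ c'')
      (g' : d' ⟶ d''), map (f ≫ f') (g ≫ g') = map f g ≫ map f' g') :
    TensorObj C D ⥤+ E :=
  let φ (X Y : TensorObj C D) : (X ⟶ Y) →+ (obj X.fst X.snd ⟶ obj Y.fst Y.snd) :=
    TensorProduct.liftAddHom
      (AddMonoidHom.mk' (fun f ↦ AddMonoidHom.mk' (map f) (map_add f))
        fun f f' ↦ AddMonoidHom.ext (add_map f f'))
      fun n f g ↦ ((AddMonoidHom.mk' (map · g) fun f f' ↦ add_map f f' g).map_zsmul n f).trans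
        ((AddMonoidHom.mk' (map f) (map_add f)).map_zsmul n g).symm
  { obj :=
      { obj := fun X ↦ obj X.fst X.snd
        map := fun {X Y} f ↦ φ X Y f
        map_id := fun X ↦ map_id X.fst X.snd
        map_comp := by
          rintro ⟨c, d⟩ ⟨c', d'⟩ ⟨c'', d''⟩ f g
          induction f using hom_induction with
          | zero => rw [Limits.zero_comp, (φ _ _).map_zero, (φ _ _).map_zero, Limits.zero_comp]
          | add f f' hf hf' => simp only [Preadditive.add_comp, (φ _ _).map_add, hf, hf']
          | tmul f f' =>
            induction g using hom_induction with
            | zero => rw [Limits.comp_zero, (φ _ _).map_zero, (φ _ _).map_zero, Limits.comp_zero]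
            | add g g' hg hg' => simp only [Preadditive.comp_add, (φ _ _).map_add, hg, hg']
            | tmul g g' => exact map_comp f f' g g' }
    property := ⟨fun {X Y f g} ↦ (φ X Y).map_add f g⟩ }

/-- Additive functors out of a tensor product are equal if they agree on objects and on the arrows
of the form `f ⊗ g`. -/
theorem TensorObj.hext {E : Type u} [Category.{u} E] [Preadditive E] {F G : TensorObj C D ⥤+ E}
    (hobj : ∀ c d, F.obj.obj ⟨c, d⟩ = G.obj.obj ⟨c, d⟩)
    (hmap : ∀ (c c' : C) (d d' : D) (f : c ⟶ c') (g : d ⟶ d'),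
      HEq (F.obj.map (tmul f g)) (G.obj.map (tmul f g))) : F = G := by
  refine ObjectProperty.FullSubcategory.ext
    (CategoryTheory.Functor.ext (fun X ↦ hobj X.fst X.snd) ?_)
  rintro ⟨c, d⟩ ⟨c', d'⟩ f
  induction f using hom_induction with
  | zero => simp
  | add f f' hf hf' =>
    simp only [Functor.map_add, hf, hf', Preadditive.comp_add, Preadditive.add_comp]
  | tmul f g => exact (conj_eqToHom_iff_heq _ _ (hobj c d) (hobj c' d')).2 (hmap _ _ _ _ f g)

theorem TensorObj.hext₃ {B E : Type u} [Category.{u} B] [Preadditive B] [Category.{u} E]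
    [Preadditive E] {F G : TensorObj (TensorObj B C) D ⥤+ E}
    (hobj : ∀ b c d, F.obj.obj ⟨⟨b, c⟩, d⟩ = G.obj.obj ⟨⟨b, c⟩, d⟩)
    (hmap : ∀ (b b' : B) (c c' : C) (d d' : D) (f : b ⟶ b') (g : c ⟶ c') (h : d ⟶ d'),
      HEq (F.obj.map (tmul (tmul f g) h)) (G.obj.map (tmul (tmul f g) h))) : F = G := by
  refine hext (fun X d ↦ hobj X.fst X.snd d) ?_
  rintro ⟨b, c⟩ ⟨b', c'⟩ d d' f h
  refine (conj_eqToHom_iff_heq _ _ (hobj b c d) (hobj b' c' d')).1 ?_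
  induction f using hom_induction with
  | zero => simp [zero_tmul]
  | add f f' hf hf' =>
    simp only [add_tmul, Functor.map_add, hf, hf', Preadditive.comp_add, Preadditive.add_comp]
  | tmul f g =>
    exact (conj_eqToHom_iff_heq _ _ (hobj b c d) (hobj b' c' d')).2 (hmap _ _ _ _ _ _ f g h)

theorem TensorObj.hext_right {B E : Type u} [Category.{u} B] [Preadditive B] [Category.{u} E]
    [Preadditive E] {F G : TensorObj B (TensorObj C D) ⥤+ E}
    (hobj : ∀ b c d, F.obj.obj ⟨b, ⟨c, d⟩⟩ = G.obj.obj ⟨b, ⟨c, d⟩⟩)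
    (hmap : ∀ (b b' : B) (c c' : C) (d d' : D) (f : b ⟶ b') (g : c ⟶ c') (h : d ⟶ d'),
      HEq (F.obj.map (tmul f (tmul g h))) (G.obj.map (tmul f (tmul g h)))) : F = G := by
  refine hext (fun b X ↦ hobj b X.fst X.snd) ?_
  rintro b b' ⟨c, d⟩ ⟨c', d'⟩ f h
  refine (conj_eqToHom_iff_heq _ _ (hobj b c d) (hobj b' c' d')).1 ?_
  induction h using hom_induction with
  | zero => simp [tmul_zero]
  | add f f' hf hf' =>
    simp only [tmul_add, Functor.map_add, hf, hf', Preadditive.comp_add, Preadditive.add_comp]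
  | tmul g h =>
    exact (conj_eqToHom_iff_heq _ _ (hobj b c d) (hobj b' c' d')).2 (hmap _ _ _ _ _ _ f g h)

theorem TensorObj.hext₄ {A B E : Type u} [Category.{u} A] [Preadditive A] [Category.{u} B]
    [Preadditive B] [Category.{u} E] [Preadditive E]
    {F G : TensorObj (TensorObj (TensorObj A B) C) D ⥤+ E}
    (hobj : ∀ a b c d, F.obj.obj ⟨⟨⟨a, b⟩, c⟩, d⟩ = G.obj.obj ⟨⟨⟨a, b⟩, c⟩, d⟩)
    (hmap : ∀ (a a' : A) (b b' : B) (c c' : C) (d d' : D) (e : a ⟶ a') (f : b ⟶ b') (g : c ⟶ c')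
      (h : d ⟶ d'), HEq (F.obj.map (tmul (tmul (tmul e f) g) h))
        (G.obj.map (tmul (tmul (tmul e f) g) h))) : F = G := by
  refine hext₃ (fun X c d ↦ hobj X.fst X.snd c d) ?_
  rintro ⟨a, b⟩ ⟨a', b'⟩ c c' d d' f g h
  refine (conj_eqToHom_iff_heq _ _ (hobj a b c d) (hobj a' b' c' d')).1 ?_
  induction f using hom_induction with
  | zero => simp [zero_tmul]
  | add f f' hf hf' =>
    simp only [add_tmul, Functor.map_add, hf, hf', Preadditive.comp_add, Preadditive.add_comp]
  | tmul e f =>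
    exact (conj_eqToHom_iff_heq _ _ (hobj a b c d) (hobj a' b' c' d')).2
      (hmap _ _ _ _ _ _ _ _ e f g h)

end Tensor

/-! ### The one-object category of a ring -/

/-- The unique object of the one-object category of `A`. -/
structure OneObj (A : Type u) : Type u where

/-- The arrows of the one-object category are the elements of the ring, and composition is
its multiplication (in the diagrammatic order). -/
instance OneObj.category (A : Type u) [Ring A] : Category.{u} (OneObj A) where
  Hom _ _ := A
  id _ := (1 : A)
  comp f g := (f * g : A)
  id_comp f := one_mul (M := A) f
  comp_id f := mul_one (M := A) f
  assoc f g h := mul_assoc (G := A) f g h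

instance OneObj.preadditive (A : Type u) [Ring A] : Preadditive (OneObj A) where
  homGroup _ _ := inferInstanceAs (AddCommGroup A)
  add_comp _ _ _ f f' g := add_mul (R := A) f f' g
  comp_add _ _ _ f g g' := mul_add (R := A) f g g'

/-- An element of the ring as an arrow of the one-object category. -/
def OneObj.arrow {A : Type u} [Ring A] (X Y : OneObj A) (a : A) : X ⟶ Y := a

/-- The functor between one-object categories given by a ring homomorphism. -/
def OneObj.map {A B : Type u} [Ring A] [Ring B] (f : A →+* B) : OneObj A ⥤ OneObj B where
  obj _ := ⟨⟩
  map a := f a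
  map_id _ := map_one f
  map_comp a b := map_mul f a b

instance {A B : Type u} [Ring A] [Ring B] (f : A →+* B) : (OneObj.map f).Additive where
  map_add {_ _ a b} := map_add f a b

/-- The underline functor from rings to `Cat(Ab)`. -/
def underline : RingCat.{u} ⥤ CatAb.{u} where
  obj A := ⟨OneObj A⟩
  map f := ofFun (OneObj.map f.hom)

/-! ### The monoidal structure -/

section

variable {C C' D D' : Type u} [Category.{u} C] [Preadditive C] [Category.{u} D] [Preadditive D]
  [Category.{u} C'] [Preadditive C'] [Category.{u} D'] [Preadditive D']

/-- The tensor product of two additive functors. -/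
noncomputable def tensorMap (F : C ⥤+ C') (G : D ⥤+ D') : TensorObj C D ⥤+ TensorObj C' D' :=
  TensorObj.lift (fun c d ↦ ⟨F.obj.obj c, G.obj.obj d⟩)
    (fun f g ↦ tmul (F.obj.map f) (G.obj.map g))
    (fun f f' g ↦ by rw [Functor.map_add, add_tmul])
    (fun f g g' ↦ by rw [Functor.map_add, tmul_add])
    (fun c d ↦ by rw [CategoryTheory.Functor.map_id, CategoryTheory.Functor.map_id, tmul_id])
    (fun f g f' g' ↦ by rw [Functor.map_comp, Functor.map_comp, tmul_comp])

theorem tensorMap_tmul (F : C ⥤+ C') (G : D ⥤+ D') {c c' : C} {d d' : D} (f : c ⟶ c')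
    (g : d ⟶ d') :
    (tensorMap F G).obj.map (tmul f g) = tmul (F.obj.map f) (G.obj.map g) := rfl

variable (C D)

/-- The left unitor: `n ⊗ f ↦ n • f` on arrows. -/
noncomputable def leftUnitorHom : TensorObj (OneObj (ULift.{u} ℤ)) C ⥤+ C :=
  TensorObj.lift (fun _ c ↦ c) (fun (n : ULift.{u} ℤ) f ↦ n.down • f)
    (fun n n' f ↦ add_zsmul f (ULift.down n) (ULift.down n'))
    (fun n f f' ↦ zsmul_add f f' (ULift.down n))
    (fun _ c ↦ one_zsmul (𝟙 c))
    (fun n f n' f' ↦ by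
      rw [Preadditive.zsmul_comp, Preadditive.comp_zsmul]
      exact mul_zsmul (f ≫ f') (ULift.down n) (ULift.down n'))

/-- The inverse of the left unitor: `f ↦ 1 ⊗ f` on arrows. -/
noncomputable def leftUnitorInv : C ⥤+ TensorObj (OneObj (ULift.{u} ℤ)) C where
  obj :=
    { obj := fun c ↦ ⟨⟨⟩, c⟩
      map := fun f ↦ tmul (𝟙 _) f
      map_id := fun _ ↦ rfl
      map_comp := fun f g ↦ by rw [tmul_comp, Category.comp_id] }
  property := ⟨fun {_ _ f g} ↦ tmul_add _ f g⟩

/-- The right unitor: `f ⊗ n ↦ n • f` on arrows. -/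
noncomputable def rightUnitorHom : TensorObj C (OneObj (ULift.{u} ℤ)) ⥤+ C :=
  TensorObj.lift (fun c _ ↦ c) (fun f (n : ULift.{u} ℤ) ↦ n.down • f)
    (fun f f' n ↦ zsmul_add f f' (ULift.down n))
    (fun f n n' ↦ add_zsmul f (ULift.down n) (ULift.down n'))
    (fun c _ ↦ one_zsmul (𝟙 c))
    (fun f n f' n' ↦ by
      rw [Preadditive.zsmul_comp, Preadditive.comp_zsmul]
      exact mul_zsmul (f ≫ f') (ULift.down n) (ULift.down n'))

/-- The inverse of the right unitor: `f ↦ f ⊗ 1` on arrows. -/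
noncomputable def rightUnitorInv : C ⥤+ TensorObj C (OneObj (ULift.{u} ℤ)) where
  obj :=
    { obj := fun c ↦ ⟨c, ⟨⟩⟩
      map := fun f ↦ tmul f (𝟙 _)
      map_id := fun _ ↦ rfl
      map_comp := fun f g ↦ by rw [tmul_comp, Category.comp_id] }
  property := ⟨fun {_ _ f g} ↦ add_tmul f g _⟩

variable {C} in
theorem arrow_tmul {c c' : C} (X Y : OneObj (ULift.{u} ℤ)) (n : ULift.{u} ℤ) (f : c ⟶ c') :
    tmul (OneObj.arrow X Y n) f = tmul (OneObj.arrow X Y 1) (n.down • f) :=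
  Eq.trans (congrArg (fun m : ULift.{u} ℤ ↦ m ⊗ₜ[ℤ] f) (ULift.ext _ _ (by simp [OneObj.arrow])))
    (TensorProduct.smul_tmul n.down (1 : ULift.{u} ℤ) f)

variable {C} in
theorem tmul_arrow {c c' : C} (X Y : OneObj (ULift.{u} ℤ)) (n : ULift.{u} ℤ) (f : c ⟶ c') :
    tmul f (OneObj.arrow X Y n) = tmul (n.down • f) (OneObj.arrow X Y 1) :=
  Eq.trans (congrArg (fun m : ULift.{u} ℤ ↦ f ⊗ₜ[ℤ] m) (ULift.ext _ _ (by simp [OneObj.arrow])))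
    (TensorProduct.smul_tmul n.down f (1 : ULift.{u} ℤ)).symm

variable (E : Type u) [Category.{u} E] [Preadditive E]

variable {C D E} in
/-- The additive map `f ⊗ g ↦ f ⊗ (g ⊗ h)`. -/
noncomputable def assocMap (X Y : TensorObj C D) {e e' : E} (h : e ⟶ e') :
    (X ⟶ Y) →+ (TensorObj.mk X.fst (TensorObj.mk X.snd e) ⟶
      TensorObj.mk Y.fst (TensorObj.mk Y.snd e')) :=
  ((TensorProduct.assoc ℤ (X.fst ⟶ Y.fst) (X.snd ⟶ Y.snd) (e ⟶ e')).toLinearMap ∘ₗ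
    (TensorProduct.mk ℤ _ (e ⟶ e')).flip h).toAddMonoidHom

variable {C D E} in
theorem assocMap_tmul {c c' : C} {d d' : D} {e e' : E} (f : c ⟶ c') (g : d ⟶ d') (h : e ⟶ e') :
    assocMap _ _ h (tmul f g) = tmul f (tmul g h) := rfl

variable {C D E} in
/-- The additive map `g ⊗ h ↦ (f ⊗ g) ⊗ h`. -/
noncomputable def assocInvMap {c c' : C} (f : c ⟶ c') (X Y : TensorObj D E) :
    (X ⟶ Y) →+ (TensorObj.mk (TensorObj.mk c X.fst) X.snd ⟶
      TensorObj.mk (TensorObj.mk c' Y.fst) Y.snd) :=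
  ((TensorProduct.assoc ℤ (c ⟶ c') (X.fst ⟶ Y.fst) (X.snd ⟶ Y.snd)).symm.toLinearMap ∘ₗ
    (TensorProduct.mk ℤ (c ⟶ c') _) f).toAddMonoidHom

variable {C D E} in
theorem assocInvMap_tmul {c c' : C} {d d' : D} {e e' : E} (f : c ⟶ c') (g : d ⟶ d')
    (h : e ⟶ e') : assocInvMap f _ _ (tmul g h) = tmul (tmul f g) h := rfl

/-- The associator: `(f ⊗ g) ⊗ h ↦ f ⊗ (g ⊗ h)` on arrows. -/
noncomputable def assocHom : TensorObj (TensorObj C D) E ⥤+ TensorObj C (TensorObj D E) :=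
  TensorObj.lift (fun X e ↦ ⟨X.fst, ⟨X.snd, e⟩⟩) (fun f h ↦ assocMap _ _ h f)
    (fun f f' h ↦ map_add _ f f')
    (by
      rintro ⟨c, d⟩ ⟨c', d'⟩ e e' f h h'
      induction f using hom_induction with
      | zero => simp only [map_zero, add_zero]
      | add f f' hf hf' => simp only [map_add, hf, hf']; abel
      | tmul f g => exact (congrArg (tmul f) (tmul_add g h h')).trans (tmul_add f _ _))
    (fun _ _ ↦ rfl)
    (by
      rintro ⟨c, d⟩ ⟨c', d'⟩ ⟨c'', d''⟩ e e' e'' f h f' h'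
      induction f using hom_induction with
      | zero => simp only [map_zero, Limits.zero_comp]
      | add f g hf hg => simp only [map_add, Preadditive.add_comp, hf, hg]
      | tmul f g =>
        induction f' using hom_induction with
        | zero => simp only [map_zero, Limits.comp_zero]
        | add f g hf hg => simp only [map_add, Preadditive.comp_add, hf, hg]
        | tmul f' g' => rfl)

/-- The inverse of the associator: `f ⊗ (g ⊗ h) ↦ (f ⊗ g) ⊗ h` on arrows. -/
noncomputable def assocInv : TensorObj C (TensorObj D E) ⥤+ TensorObj (TensorObj C D) E :=
  TensorObj.lift (fun c X ↦ ⟨⟨c, X.fst⟩, X.snd⟩) (fun f h ↦ assocInvMap f _ _ h)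
    (by
      rintro c c' ⟨d, e⟩ ⟨d', e'⟩ f f' h
      induction h using hom_induction with
      | zero => simp only [map_zero, add_zero]
      | add h h' hh hh' => simp only [map_add, hh, hh']; abel
      | tmul g h => exact (congrArg (tmul · h) (add_tmul f f' g)).trans (add_tmul _ _ h))
    (fun f h h' ↦ map_add _ h h')
    (fun _ _ ↦ rfl)
    (by
      rintro c c' c'' ⟨d, e⟩ ⟨d', e'⟩ ⟨d'', e''⟩ f h f' h'
      induction h using hom_induction with
      | zero => simp only [map_zero, Limits.zero_comp]
      | add h g hh hg => simp only [map_add, Preadditive.add_comp, hh, hg]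
      | tmul h g =>
        induction h' using hom_induction with
        | zero => simp only [map_zero, Limits.comp_zero]
        | add h' g' hh hg => simp only [map_add, Preadditive.comp_add, hh, hg]
        | tmul h' g' => rfl)

variable {C D E} in
theorem assocHom_tmul {c c' : C} {d d' : D} {e e' : E} (f : c ⟶ c') (g : d ⟶ d') (h : e ⟶ e') :
    (assocHom C D E).obj.map (tmul (tmul f g) h) = tmul f (tmul g h) := rfl

variable {C D E} in
theorem pentagon_tmul {B : Type u} [Category.{u} B] [Preadditive B] {b b' : B} {c c' : C}
    {d d' : D} {x x' : E} (e : b ⟶ b') (f : c ⟶ c') (g : d ⟶ d') (h : x ⟶ x') :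
    (tensorMap (AdditiveFunctor.of (𝟭 B)) (assocHom C D E)).obj.map
      ((assocHom B (TensorObj C D) E).obj.map
        ((tensorMap (assocHom B C D) (AdditiveFunctor.of (𝟭 E))).obj.map
          (tmul (tmul (tmul e f) g) h))) =
      (assocHom B C (TensorObj D E)).obj.map
        ((assocHom (TensorObj B C) D E).obj.map (tmul (tmul (tmul e f) g) h)) := by
  have h₁ : (tensorMap (assocHom B C D) (AdditiveFunctor.of (𝟭 E))).obj.map
      (tmul (tmul (tmul e f) g) h) = tmul (tmul e (tmul f g)) h :=
    (tensorMap_tmul _ _ _ _).trans rfl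
  have h₂ : (assocHom B (TensorObj C D) E).obj.map (tmul (tmul e (tmul f g)) h) =
    tmul e (tmul (tmul f g) h) := rfl
  have h₃ : (tensorMap (AdditiveFunctor.of (𝟭 B)) (assocHom C D E)).obj.map
      (tmul e (tmul (tmul f g) h)) = tmul e (tmul f (tmul g h)) :=
    (tensorMap_tmul _ _ _ _).trans rfl
  exact (congrArg (fun x ↦ (tensorMap (AdditiveFunctor.of (𝟭 B)) (assocHom C D E)).obj.map
    ((assocHom B (TensorObj C D) E).obj.map x)) h₁).trans
      ((congrArg (fun x ↦
        (tensorMap (AdditiveFunctor.of (𝟭 B)) (assocHom C D E)).obj.map x) h₂).trans h₃)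

end

noncomputable instance : MonoidalCategoryStruct CatAb.{u} where
  tensorObj C D := ⟨TensorObj C D⟩
  whiskerLeft C _ _ F := tensorMap (𝟙 C) F
  whiskerRight F C := tensorMap F (𝟙 C)
  tensorHom F G := tensorMap F G
  tensorUnit := ⟨OneObj (ULift.{u} ℤ)⟩
  associator C D E :=
    { hom := assocHom C D E
      inv := assocInv C D E
      hom_inv_id := TensorObj.hext₃ (fun _ _ _ ↦ rfl) fun _ _ _ _ _ _ _ _ _ ↦ HEq.rfl
      inv_hom_id := TensorObj.hext_right (fun _ _ _ ↦ rfl) fun _ _ _ _ _ _ _ _ _ ↦ HEq.rfl }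
  leftUnitor C :=
    { hom := leftUnitorHom C
      inv := leftUnitorInv C
      hom_inv_id := TensorObj.hext (fun _ _ ↦ rfl) fun X Y _ _ n f ↦
        heq_of_eq (arrow_tmul X Y n f).symm
      inv_hom_id := hom_hext (fun _ ↦ rfl) fun _ _ f ↦ heq_of_eq (one_zsmul f) }
  rightUnitor C :=
    { hom := rightUnitorHom C
      inv := rightUnitorInv C
      hom_inv_id := TensorObj.hext (fun _ _ ↦ rfl) fun _ _ X Y f n ↦
        heq_of_eq (tmul_arrow X Y n f).symm
      inv_hom_id := hom_hext (fun _ ↦ rfl) fun _ _ f ↦ heq_of_eq (one_zsmul f) }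

section

variable {C C' D D' E E' : CatAb.{u}}

theorem associator_nat (F : C ⟶ C') (G : D ⟶ D') (H : E ⟶ E') :
    ((F ⊗ₘ G) ⊗ₘ H) ≫ (α_ C' D' E').hom = (α_ C D E).hom ≫ (F ⊗ₘ (G ⊗ₘ H)) :=
  TensorObj.hext₃ (fun _ _ _ ↦ rfl) fun _ _ _ _ _ _ _ _ _ ↦ HEq.rfl

theorem leftUnitor_nat (F : C ⟶ C') : (𝟙 (𝟙_ CatAb.{u}) ⊗ₘ F) ≫ (λ_ C').hom = (λ_ C).hom ≫ F :=
  TensorObj.hext (fun _ _ ↦ rfl) fun _ _ _ _ n f ↦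
    heq_of_eq (F.obj.map_zsmul (f := f) (r := ULift.down n)).symm

theorem rightUnitor_nat (F : C ⟶ C') : (F ⊗ₘ 𝟙 (𝟙_ CatAb.{u})) ≫ (ρ_ C').hom = (ρ_ C).hom ≫ F :=
  TensorObj.hext (fun _ _ ↦ rfl) fun _ _ _ _ f n ↦
    heq_of_eq (F.obj.map_zsmul (f := f) (r := ULift.down n)).symm

theorem triangle_eq (C D : CatAb.{u}) :
    (α_ C (𝟙_ CatAb.{u}) D).hom ≫ (𝟙 C ⊗ₘ (λ_ D).hom) = (ρ_ C).hom ⊗ₘ 𝟙 D :=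
  TensorObj.hext₃ (fun _ _ _ ↦ rfl) fun _ _ _ _ _ _ f n g ↦
    heq_of_eq (TensorProduct.smul_tmul (R := ℤ) (ULift.down n) f g).symm

theorem pentagon_eq (B C D E : CatAb.{u}) :
    ((α_ B C D).hom ⊗ₘ 𝟙 E) ≫ (α_ B (C ⊗ D) E).hom ≫ (𝟙 B ⊗ₘ (α_ C D E).hom) =
      (α_ (B ⊗ C) D E).hom ≫ (α_ B C (D ⊗ E)).hom :=
  TensorObj.hext₄ (fun _ _ _ _ ↦ rfl) fun _ _ _ _ _ _ _ _ e f g h ↦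
    heq_of_eq (pentagon_tmul e f g h)

end

noncomputable instance : MonoidalCategory CatAb.{u} :=
  MonoidalCategory.ofTensorHom
    (id_tensorHom_id := fun _ _ ↦ TensorObj.hext (fun _ _ ↦ rfl) fun _ _ _ _ _ _ ↦ HEq.rfl)
    (id_tensorHom := fun _ _ _ _ ↦ rfl)
    (tensorHom_id := fun _ _ ↦ rfl)
    (tensorHom_comp_tensorHom := fun _ _ _ _ ↦
      TensorObj.hext (fun _ _ ↦ rfl) fun _ _ _ _ _ _ ↦ HEq.rfl)
    (associator_naturality := associator_nat)
    (leftUnitor_naturality := leftUnitor_nat)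
    (rightUnitor_naturality := rightUnitor_nat)
    (pentagon := pentagon_eq)
    (triangle := triangle_eq)

end CatAb

namespace CatAb

theorem assoc_ext {A B C D E F : CatAb.{u}} (M : A ⊗ B ⟶ D) (M' : D ⊗ C ⟶ F) (N : B ⊗ C ⟶ E)
    (N' : A ⊗ E ⟶ F)
    (hobj : ∀ a b c, (fn M').obj ⟨(fn M).obj ⟨a, b⟩, c⟩ = (fn N').obj ⟨a, (fn N).obj ⟨b, c⟩⟩)
    (hmap : ∀ (a a' : A) (b b' : B) (c c' : C) (f : a ⟶ a') (g : b ⟶ b') (h : c ⟶ c'),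
      HEq ((fn M').map (tmul ((fn M).map (tmul f g)) h))
        ((fn N').map (tmul f ((fn N).map (tmul g h))))) :
    (α_ A B C).inv ≫ M ▷ C ≫ M' = A ◁ N ≫ N' :=
  TensorObj.hext_right hobj hmap

/-! ### The internal hom and the self-enrichment of `Cat(Ab)` -/

/-- The internal hom of `Cat(Ab)`: the preadditive category of additive functors and natural
transformations. -/
def ihom (C D : CatAb.{u}) : CatAb.{u} := ⟨C ⥤+ D⟩

/-- The additive functor from the unit of `Cat(Ab)` which picks out an object. -/
def pick {D : Type u} [Category.{u} D] [Preadditive D] (X : D) : OneObj (ULift.{u} ℤ) ⥤+ D where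
  obj :=
    { obj := fun _ ↦ X
      map := fun (n : ULift.{u} ℤ) ↦ n.down • 𝟙 X
      map_id := fun _ ↦ one_zsmul _
      map_comp := fun m n ↦ by
        rw [Preadditive.zsmul_comp, Preadditive.comp_zsmul, Category.comp_id]
        exact mul_zsmul (𝟙 X) (ULift.down m) (ULift.down n) }
  property := ⟨fun {_ _ m n} ↦ add_zsmul (𝟙 X) (ULift.down m) (ULift.down n)⟩

section

variable (C D E : Type u) [Category.{u} C] [Preadditive C] [Category.{u} D] [Preadditive D]
  [Category.{u} E] [Preadditive E]

/-- Composition of additive functors as an additive functor on the tensor product of functor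
categories: it is the horizontal composition of natural transformations on arrows. -/
noncomputable def compFun : TensorObj (C ⥤+ D) (D ⥤+ E) ⥤+ (C ⥤+ E) :=
  TensorObj.lift (fun F G ↦ AdditiveFunctor.of (F.obj ⋙ G.obj))
    (fun α β ↦ ObjectProperty.homMk (α.hom ◫ β.hom))
    (fun {_ _} G G' α α' β ↦ ObjectProperty.hom_ext _ <| NatTrans.ext <| funext fun X ↦ by
      change β.hom.app _ ≫ G'.obj.map (α.hom.app X + α'.hom.app X) =
        β.hom.app _ ≫ G'.obj.map (α.hom.app X) + β.hom.app _ ≫ G'.obj.map (α'.hom.app X)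
      rw [Functor.map_add, Preadditive.comp_add])
    (fun {_ _} G G' α β β' ↦ ObjectProperty.hom_ext _ <| NatTrans.ext <| funext fun X ↦
      Preadditive.add_comp _ _ _ (β.hom.app _) (β'.hom.app _) (G'.obj.map (α.hom.app X)))
    (fun F G ↦ ObjectProperty.hom_ext _ <| NatTrans.ext <| funext fun X ↦ by
      change 𝟙 (G.obj.obj (F.obj.obj X)) ≫ G.obj.map (𝟙 (F.obj.obj X)) = 𝟙 _
      rw [CategoryTheory.Functor.map_id, Category.comp_id])
    (fun α β α' β' ↦ ObjectProperty.hom_ext _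
      (NatTrans.exchange α.hom α'.hom β.hom β'.hom))

variable {C D E} in
theorem compFun_tmul {F F' : C ⥤+ D} {G G' : D ⥤+ E} (α : F ⟶ F') (β : G ⟶ G') :
    (compFun C D E).obj.map (tmul α β) =
      ObjectProperty.homMk (X := AdditiveFunctor.of (F.obj ⋙ G.obj))
        (Y := AdditiveFunctor.of (F'.obj ⋙ G'.obj)) (α.hom ◫ β.hom) := rfl

variable {C D E} in
theorem compFun_assoc {B : Type u} [Category.{u} B] [Preadditive B] {F F' : B ⥤+ C}
    {G G' : C ⥤+ D} {H H' : D ⥤+ E} (α : F ⟶ F') (β : G ⟶ G') (γ : H ⟶ H') :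
    (compFun B D E).obj.map (tmul ((compFun B C D).obj.map (tmul α β)) γ) =
      (compFun B C E).obj.map (tmul α ((compFun C D E).obj.map (tmul β γ))) := by
  refine ObjectProperty.hom_ext _ <| NatTrans.ext <| funext fun X ↦ ?_
  change γ.hom.app _ ≫ H'.obj.map (β.hom.app _ ≫ G'.obj.map (α.hom.app X)) =
        (γ.hom.app _ ≫ H'.obj.map (β.hom.app _)) ≫ H'.obj.map (G'.obj.map (α.hom.app X))
  rw [Functor.map_comp, Category.assoc]

end

/-- The composition morphism of the self-enrichment. -/
noncomputable def ihomComp (C D E : CatAb.{u}) : ihom C D ⊗ ihom D E ⟶ ihom C E := compFun C D E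

theorem ihom_assoc (B C D E : CatAb.{u}) :
    (α_ (ihom B C) (ihom C D) (ihom D E)).inv ≫ ihomComp B C D ▷ ihom D E ≫ ihomComp B D E =
      ihom B C ◁ ihomComp C D E ≫ ihomComp B C E := by
  apply assoc_ext
  · intro F G H
    rfl
  · intro F F' G G' H H' α β γ
    exact heq_of_eq (compFun_assoc α β γ)

/-- `Cat(Ab)` is enriched over itself by its internal hom. -/
noncomputable instance : EnrichedCategory CatAb.{u} CatAb.{u} where
  Hom := ihom
  id C := pick (D := C ⥤+ C) (AdditiveFunctor.of (𝟭 C))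
  comp := ihomComp
  id_comp C D := hom_hext (fun _ ↦ rfl) fun F G α ↦ heq_of_eq <|
    ObjectProperty.hom_ext _ <| NatTrans.ext <| funext fun X ↦ by
      change α.hom.app X ≫ G.obj.map ((1 : ℤ) • 𝟙 X) = α.hom.app X
      rw [one_zsmul, CategoryTheory.Functor.map_id, Category.comp_id]
  comp_id C D := hom_hext (fun _ ↦ rfl) fun F G α ↦ heq_of_eq <|
    ObjectProperty.hom_ext _ <| NatTrans.ext <| funext fun X ↦ by
      change ((1 : ℤ) • 𝟙 (F.obj.obj X)) ≫ α.hom.app X = α.hom.app X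
      rw [one_zsmul, Category.id_comp]
  assoc := ihom_assoc

end CatAb

namespace CatAb

/-! ### The monoidal category of one-object categories -/

/-- The additive functor `A̲ ⊗ B̲ ⥤ C̲` given by a ring homomorphism `A ⊗ B → C`. -/
noncomputable def OneObj.ofTensor {A B C : Type u} [Ring A] [Ring B] [Ring C]
    (φ : A ⊗[ℤ] B →+* C) : TensorObj (OneObj A) (OneObj B) ⥤+ OneObj C :=
  TensorObj.lift (fun _ _ ↦ ⟨⟩) (fun (a : A) (b : B) ↦ φ (a ⊗ₜ b))
    (fun (a a' : A) (b : B) ↦ (congrArg φ (TensorProduct.add_tmul a a' b)).trans (map_add φ _ _))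
    (fun (a : A) (b b' : B) ↦ (congrArg φ (TensorProduct.tmul_add a b b')).trans (map_add φ _ _))
    (fun _ _ ↦ map_one φ)
    (fun (a : A) (b : B) (a' : A) (b' : B) ↦
      (congrArg φ (Algebra.TensorProduct.tmul_mul_tmul a a' b b').symm).trans (map_mul φ _ _))

/-- The comparison functor from the one-object category of `A ⊗ B` to `A̲ ⊗ B̲`. -/
noncomputable def OneObj.toTensor (A B : Type u) [Ring A] [Ring B] :
    OneObj (A ⊗[ℤ] B) ⥤+ TensorObj (OneObj A) (OneObj B) where
  obj :=
    { obj := fun _ ↦ ⟨⟨⟩, ⟨⟩⟩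
      map := fun x ↦ x
      map_id := fun _ ↦ rfl
      map_comp := fun (x y : A ⊗[ℤ] B) ↦ by
        change x * y = tensorComp (C := OneObj A) (D := OneObj B) ⟨⟨⟩, ⟨⟩⟩ ⟨⟨⟩, ⟨⟩⟩ ⟨⟨⟩, ⟨⟩⟩ x y
        induction x using TensorProduct.induction_on with
        | zero => exact (zero_mul y).trans (LinearMap.map_zero₂ _ _).symm
        | add x x' hx hx' =>
          exact (add_mul x x' y).trans
            ((congrArg₂ (· + ·) hx hx').trans (LinearMap.map_add₂ _ _ _ _).symm)
        | tmul a b =>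
          induction y using TensorProduct.induction_on with
          | zero => exact (mul_zero _).trans (map_zero _).symm
          | add y y' hy hy' =>
            exact (mul_add _ y y').trans ((congrArg₂ (· + ·) hy hy').trans (map_add _ _ _).symm)
          | tmul a' b' => exact Algebra.TensorProduct.tmul_mul_tmul a a' b b' }
  property := ⟨rfl⟩

/-- `A̲ ⊗ B̲` is isomorphic to the one-object category of `A ⊗ B`. -/
noncomputable def underlineTensorIso (A B : RingCat.{u}) :
    underline.obj (A ⊗ B) ≅ underline.obj A ⊗ underline.obj B where
  hom := OneObj.toTensor A B
  inv := OneObj.ofTensor (RingHom.id (A ⊗[ℤ] B))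
  hom_inv_id := hom_hext (fun _ ↦ rfl) fun _ _ (x : A ⊗[ℤ] B) ↦ heq_of_eq <| by
    change (OneObj.ofTensor (RingHom.id (A ⊗[ℤ] B))).obj.map
      ((OneObj.toTensor A B).obj.map (X := ⟨⟩) (Y := ⟨⟩) x) = x
    induction x using TensorProduct.induction_on with
    | zero => rfl
    | tmul a b => rfl
    | add x y hx hy =>
      exact (Functor.map_add (OneObj.ofTensor (RingHom.id (A ⊗[ℤ] B))).obj (X := ⟨⟨⟩, ⟨⟩⟩)
        (Y := ⟨⟨⟩, ⟨⟩⟩) (f := x) (g := y)).trans (congrArg₂ (· + ·) hx hy)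
  inv_hom_id := TensorObj.hext (fun _ _ ↦ rfl) fun _ _ _ _ _ _ ↦ HEq.rfl

/-- The objects of `Cat(Ab)` that are isomorphic to the one-object category of a ring. -/
abbrev oneObject : ObjectProperty CatAb.{u} := underline.{u}.essImage

instance : oneObject.{u}.IsMonoidal where
  prop_unit := underline.obj_mem_essImage (RingCat.of (ULift.{u} ℤ))
  prop_tensor := by
    rintro _ _ ⟨A, ⟨e⟩⟩ ⟨B, ⟨f⟩⟩
    exact ⟨A ⊗ B, ⟨underlineTensorIso A B ≪≫ (e ⊗ᵢ f)⟩⟩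

/-- `Ring̲`: the full monoidal subcategory of `Cat(Ab)` on the one-object categories of rings. -/
abbrev URing : Type (u + 1) := oneObject.{u}.FullSubcategory

noncomputable example : MonoidalCategory URing.{u} := inferInstance

/-- `Ring̲` as a full `Cat(Ab)`-enriched subcategory of `Cat(Ab)`. -/
noncomputable instance : EnrichedCategory CatAb.{u} URing.{u} where
  Hom C D := C.obj ⟶[CatAb.{u}] D.obj
  id C := eId CatAb.{u} C.obj
  comp C D E := eComp CatAb.{u} C.obj D.obj E.obj

variable (R : Type u) [CommRing R]

/-- `R̲` is a monoid in `Cat(Ab)` for a commutative ring `R`: the multiplication functor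
`R̲ ⊗ R̲ ⥤ R̲` is the multiplication of `R` on arrows. -/
noncomputable instance : MonObj (underline.obj (RingCat.of R)) where
  one := underline.map (MonObj.one : 𝟙_ RingCat.{u} ⟶ RingCat.of R)
  mul := OneObj.ofTensor (MonObj.mul : RingCat.of R ⊗ RingCat.of R ⟶ RingCat.of R).hom
  one_mul := TensorObj.hext (fun _ _ ↦ rfl) fun _ _ _ _ (n : ULift.{u} ℤ) (a : R) ↦
    heq_of_eq (zsmul_eq_mul a n.down).symm
  mul_one := TensorObj.hext (fun _ _ ↦ rfl) fun _ _ _ _ (a : R) (n : ULift.{u} ℤ) ↦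
    heq_of_eq ((zsmul_eq_mul a n.down).trans (mul_comm _ _)).symm
  mul_assoc := TensorObj.hext₃ (fun _ _ _ ↦ rfl) fun _ _ _ _ _ _ (a : R) (b : R) (c : R) ↦
    heq_of_eq (mul_assoc a b c)

/-- `R̲` as an object of `Ring̲`. -/
def uring : URing.{u} := ⟨underline.obj (RingCat.of R), underline.obj_mem_essImage _⟩

noncomputable instance : MonObj (uring R) where
  one := ObjectProperty.homMk (MonObj.one (X := underline.obj (RingCat.of R)))
  mul := ObjectProperty.homMk (MonObj.mul (X := underline.obj (RingCat.of R)))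
  one_mul := ObjectProperty.hom_ext _ (MonObj.one_mul (underline.obj (RingCat.of R)))
  mul_one := ObjectProperty.hom_ext _ (MonObj.mul_one (underline.obj (RingCat.of R)))
  mul_assoc := ObjectProperty.hom_ext _ (MonObj.mul_assoc (underline.obj (RingCat.of R)))

end CatAb

namespace VCat

/-! ### Categories of enriched functors -/

section

variable {V : Type v} [Category.{w} V] [MonoidalCategory V]

/-- The unique object of the one-object `V`-category of a monoid `M` in `V`. -/
structure Deloop (M : V) : Type where

/-- The one-object `V`-category of a monoid `M` in `V`: its hom-object is `M` and its composition
is the multiplication of `M`. -/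
instance (M : V) [MonObj M] : EnrichedCategory V (Deloop M) where
  Hom _ _ := M
  id _ := MonObj.one
  comp _ _ _ := MonObj.mul
  id_comp _ _ := by simp
  comp_id _ _ := by simp
  assoc _ _ _ _ := by simp

variable (V) {C : Type*} [EnrichedCategory V C] {D : Type*} [EnrichedCategory V D]

/-- Precomposition with an arrow `f : X ⟶ Y` of a `V`-category. -/
def pre {X Y : D} (f : 𝟙_ V ⟶ (X ⟶[V] Y)) (Z : D) : (Y ⟶[V] Z) ⟶ (X ⟶[V] Z) :=
  (λ_ _).inv ≫ f ▷ _ ≫ eComp V X Y Z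

/-- Postcomposition with an arrow `f : X ⟶ Y` of a `V`-category. -/
def post {X Y : D} (f : 𝟙_ V ⟶ (X ⟶[V] Y)) (Z : D) : (Z ⟶[V] X) ⟶ (Z ⟶[V] Y) :=
  (ρ_ _).inv ≫ _ ◁ f ≫ eComp V Z X Y

/-- Composition of arrows of a `V`-category. -/
def compArrow {X Y Z : D} (f : 𝟙_ V ⟶ (X ⟶[V] Y)) (g : 𝟙_ V ⟶ (Y ⟶[V] Z)) :
    𝟙_ V ⟶ (X ⟶[V] Z) :=
  (λ_ (𝟙_ V)).inv ≫ (f ⊗ₘ g) ≫ eComp V X Y Z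

theorem pre_id (X Z : D) : pre V (eId V X) Z = 𝟙 _ := e_id_comp V X Z

theorem post_id (X Z : D) : post V (eId V X) Z = 𝟙 _ := e_comp_id V Z X

theorem compArrow_eq_post {X Y Z : D} (f : 𝟙_ V ⟶ (X ⟶[V] Y)) (g : 𝟙_ V ⟶ (Y ⟶[V] Z)) :
    compArrow V f g = f ≫ post V g X := by
  simp [compArrow, post, MonoidalCategory.tensorHom_def, unitors_inv_equal]

theorem compArrow_eq_pre {X Y Z : D} (f : 𝟙_ V ⟶ (X ⟶[V] Y)) (g : 𝟙_ V ⟶ (Y ⟶[V] Z)) :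
    compArrow V f g = g ≫ pre V f Z := by
  simp [compArrow, pre, MonoidalCategory.tensorHom_def']

theorem pre_post {W X Y Z : D} (f : 𝟙_ V ⟶ (W ⟶[V] X)) (g : 𝟙_ V ⟶ (Y ⟶[V] Z)) :
    pre V f Y ≫ post V g W = post V g X ≫ pre V f Z := by
  simp only [pre, post, Category.assoc]
  rw [rightUnitor_inv_naturality_assoc, ← whisker_exchange_assoc, ← e_assoc' V W X Y Z,
    leftUnitor_inv_naturality_assoc, whisker_exchange_assoc,
    leftUnitor_inv_naturality_assoc, whisker_exchange_assoc,
    rightUnitor_inv_naturality_assoc, rightUnitor_inv_naturality_assoc]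
  have h : (ρ_ (X ⟶[V] Y)).inv ≫ (λ_ ((X ⟶[V] Y) ⊗ 𝟙_ V)).inv ≫
      (α_ (𝟙_ V) (X ⟶[V] Y) (𝟙_ V)).inv ≫ (ρ_ (𝟙_ V ⊗ (X ⟶[V] Y))).hom =
        (λ_ (X ⟶[V] Y)).inv := by monoidal
  simp [reassoc_of% h]

theorem post_comp {X Y Z : D} (f : 𝟙_ V ⟶ (X ⟶[V] Y)) (g : 𝟙_ V ⟶ (Y ⟶[V] Z)) (W : D) :
    post V (compArrow V f g) W = post V f W ≫ post V g W := by
  simp only [compArrow_eq_post, post, Category.assoc, MonoidalCategory.whiskerLeft_comp]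
  rw [← e_assoc V W X Y Z, rightUnitor_inv_naturality_assoc, rightUnitor_inv_naturality_assoc,
    ← whisker_exchange_assoc]
  simp

theorem pre_comp {X Y Z : D} (f : 𝟙_ V ⟶ (X ⟶[V] Y)) (g : 𝟙_ V ⟶ (Y ⟶[V] Z)) (W : D) :
    pre V (compArrow V f g) W = pre V g W ≫ pre V f W := by
  simp only [compArrow_eq_pre, pre, Category.assoc, comp_whiskerRight]
  rw [← e_assoc' V X Y Z W, leftUnitor_inv_naturality_assoc, leftUnitor_inv_naturality_assoc,
    whisker_exchange_assoc]
  simp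

variable (C D)

/-- `V`-enriched functors, as the objects of the category `Fun^V(C, D)` whose morphisms are the
`V`-enriched natural transformations. -/
structure Fun where
  /-- The enriched functor. -/
  functor : EnrichedFunctor V C D

variable {C D}

/-- A `V`-enriched natural transformation. Its naturality is a condition on the hom-objects
of `C`. -/
@[ext]
structure NatTrans (F G : EnrichedFunctor V C D) where
  /-- The components. -/
  app (X : C) : 𝟙_ V ⟶ (F.obj X ⟶[V] G.obj X)
  naturality (X Y : C) :
    F.map X Y ≫ post V (app Y) (F.obj X) = G.map X Y ≫ pre V (app X) (G.obj Y)

instance : Category (Fun V C D) where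
  Hom F G := NatTrans V F.functor G.functor
  id F :=
    { app := fun X ↦ eId V (F.functor.obj X)
      naturality := fun X Y ↦ by rw [pre_id, post_id] }
  comp {F G H} α β :=
    { app := fun X ↦ compArrow V (α.app X) (β.app X)
      naturality := fun X Y ↦ by
        rw [post_comp, pre_comp, ← Category.assoc, α.naturality, Category.assoc, pre_post,
          ← Category.assoc, β.naturality, Category.assoc] }
  id_comp {F G} α := NatTrans.ext <| funext fun X ↦
    (compArrow_eq_pre V _ _).trans (by rw [pre_id, Category.comp_id])
  comp_id {F G} α := NatTrans.ext <| funext fun X ↦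
    (compArrow_eq_post V _ _).trans (by rw [post_id, Category.comp_id])
  assoc {F G H K} α β γ := NatTrans.ext <| funext fun X ↦ by
    change compArrow V (compArrow V _ _) _ = compArrow V _ (compArrow V _ _)
    rw [compArrow_eq_post, compArrow_eq_post, compArrow_eq_post, post_comp, Category.assoc]

end

/-! ### Enriched functors into the base -/

section

variable (V : Type v) [Category.{w} V] [MonoidalCategory V] (C : Type*) [EnrichedCategory V C]

/-- A `V`-enriched functor from a `V`-category `C` to `V` itself. The maps
`C(X, Y) → [F X, F Y]` into the internal homs are given by their transposes
`F X ⊗ C(X, Y) → F Y`, so that `V` is not required to be closed. -/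
structure FunToSelf where
  /-- The values on objects. -/
  obj : C → V
  /-- The transposes of the maps on hom-objects. -/
  act (X Y : C) : obj X ⊗ (X ⟶[V] Y) ⟶ obj Y
  act_id (X : C) : (ρ_ (obj X)).inv ≫ obj X ◁ eId V X ≫ act X X = 𝟙 (obj X)
  act_comp (X Y Z : C) : (α_ (obj X) (X ⟶[V] Y) (Y ⟶[V] Z)).hom ≫
    obj X ◁ eComp V X Y Z ≫ act X Z = act X Y ▷ (Y ⟶[V] Z) ≫ act Y Z

variable {V C}

/-- A `V`-enriched natural transformation between enriched functors to `V`. The components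
`𝟙 → [F X, G X]` are given by their transposes `F X → G X`. -/
@[ext]
structure FunToSelf.Hom (F G : FunToSelf V C) where
  /-- The components. -/
  app (X : C) : F.obj X ⟶ G.obj X
  naturality (X Y : C) : F.act X Y ≫ app Y = app X ▷ (X ⟶[V] Y) ≫ G.act X Y

instance : Category (FunToSelf V C) where
  Hom F G := FunToSelf.Hom F G
  id F :=
    { app := fun X ↦ 𝟙 (F.obj X)
      naturality := fun X Y ↦ by simp }
  comp α β :=
    { app := fun X ↦ α.app X ≫ β.app X
      naturality := fun X Y ↦ by
        rw [← Category.assoc, α.naturality, Category.assoc, β.naturality, comp_whiskerRight,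
          Category.assoc] }
  id_comp α := FunToSelf.Hom.ext <| funext fun X ↦ Category.id_comp _
  comp_id α := FunToSelf.Hom.ext <| funext fun X ↦ Category.comp_id _
  assoc α β γ := FunToSelf.Hom.ext <| funext fun X ↦ Category.assoc _ _ _

end

end VCat

/-!
All four categories are equivalent to the category of `R`-algebras. A left `R`-module in the
category of rings is a ring `A` with a ring homomorphism `R ⊗ A → A`, `1 ⊗ a ↦ a`. In `R ⊗ A` the
elements `r ⊗ 1` and `1 ⊗ a` commute, so that such a homomorphism amounts to a ring homomorphism
from `R` to the centre of `A` (`RingCat.algebraOfAction`, `RingCat.actionHom`), and the linear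
morphisms are the algebra homomorphisms.

Additive functors `A̲ ⥤ B̲` and `A̲ ⊗ B̲ ⥤ C̲` are ring homomorphisms `A → B` and `A ⊗ B → C`. Hence
modules over `R̲` in `Ring̲` whose underlying category is `A̲` are again `R`-algebra structures on
`A`, and so are the transposed actions `A̲ ⊗ R̲ ⟶ A̲`, because `R` is commutative. A general object of
`Ring̲` is only isomorphic to some `A̲`, and the structure is transported along the isomorphism.

A `Cat(Ab)`-enriched functor with value `A̲` is a functor from `R̲` to the endofunctors of `A̲` which
sends the object to the identity functor. An endomorphism of the identity functor of `A̲` is a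
central element of `A`, so that this is a ring homomorphism from `R` to the centre of `A` once more
(`CatAb.scalarFunctor`, `CatAb.scalarHom`). An enriched transformation is determined by the additive
functor `A̲ ⥤ B̲` that its component picks out (`CatAb.hom_unit_ext`), and its naturality says that
this functor preserves the scalars.

For each of the four categories there is a functor from `AlgCat R`, and it is shown to be faithful,
full and essentially surjective.
-/

namespace CategoryTheory.Mod

open scoped MonoidalLeftAction

/-- An isomorphism of the underlying objects that commutes with the actions is an isomorphism of
module objects. -/
def isoOfIso {C D : Type*} [Category* C] [MonoidalCategory C] [Category* D]
    [MonoidalLeftAction C D] {A : C} [MonObj A] {M N : Mod D A} (e : M.X ≅ N.X)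
    (h : ModObj.smul (M := A) ≫ e.hom = A ⊴ₗ e.hom ≫ ModObj.smul (M := A)) : M ≅ N :=
  haveI : IsModHom A e.hom := ⟨h⟩
  { hom := ⟨e.hom⟩
    inv := ⟨e.inv⟩
    hom_inv_id := Mod.hom_ext _ _ e.hom_inv_id
    inv_hom_id := Mod.hom_ext _ _ e.inv_hom_id }

end CategoryTheory.Mod

namespace RingCat

/-! ### Unital actions of a commutative ring on a ring -/

section

variable (R : Type*) [CommRing R] (A : Type*) [Ring A]

/-- The action `r ⊗ a ↦ r • a` of `R` on an `R`-algebra, as a ring homomorphism. -/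
noncomputable def actionHom [Algebra R A] : R ⊗[ℤ] A →+* A :=
  (Algebra.TensorProduct.lift (algebraMap R A).toIntAlgHom (AlgHom.id ℤ A)
    fun r a ↦ Algebra.commutes r a).toRingHom

@[simp]
theorem actionHom_tmul [Algebra R A] (r : R) (a : A) :
    actionHom R A (r ⊗ₜ a) = algebraMap R A r * a := rfl

variable {R A}

/-- A ring homomorphism `R ⊗ A → A` with `1 ⊗ a ↦ a` makes `A` an `R`-algebra: the elements
`r ⊗ 1` and `1 ⊗ a` commute, so that `r ⊗ 1` is sent to the centre of `A`. Associativity of the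
action need not be assumed, since it is a ring homomorphism on the elements `r ⊗ 1`. -/
abbrev algebraOfAction (g : R ⊗[ℤ] A →+* A) (hg : ∀ a, g (1 ⊗ₜ a) = a) : Algebra R A :=
  (g.comp (Algebra.TensorProduct.includeLeftRingHom : R →+* R ⊗[ℤ] A)).toAlgebra' fun r a ↦ by
    change g (r ⊗ₜ 1) * a = a * g (r ⊗ₜ 1)
    conv_lhs => rw [← hg a]
    conv_rhs => rw [← hg a]
    rw [← map_mul, ← map_mul, Algebra.TensorProduct.tmul_mul_tmul,
      Algebra.TensorProduct.tmul_mul_tmul, one_mul, mul_one, one_mul, mul_one]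

/-- The given action is recovered from the algebra structure, as `r ⊗ a = (r ⊗ 1) * (1 ⊗ a)`. -/
theorem actionHom_algebraOfAction (g : R ⊗[ℤ] A →+* A) (hg : ∀ a, g (1 ⊗ₜ a) = a) :
    letI := algebraOfAction g hg
    actionHom R A = g := by
  let := algebraOfAction g hg
  refine tensor_ringHom_ext fun r a ↦ ?_
  change g (r ⊗ₜ 1) * a = g (r ⊗ₜ a)
  conv_lhs => rw [← hg a]
  rw [← map_mul, Algebra.TensorProduct.tmul_mul_tmul, mul_one, one_mul]

end

/-! ### Modules over `R` in the category of rings -/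

variable (R : Type u) [CommRing R]

/-- An `R`-algebra as a module over `R` in the category of rings. -/
noncomputable def modOfAlg : AlgCat.{u} R ⥤ Mod RingCat.{u} (RingCat.of R) where
  obj A :=
    { X := RingCat.of A
      mod :=
        { smul := RingCat.ofHom (actionHom R A)
          one_smul := tensor_hom_ext fun n a ↦ by
            change algebraMap R A ((n.down : ℤ) : R) * a = n.down • a
            rw [map_intCast, zsmul_eq_mul]
          mul_smul := tensor_hom_ext₃ fun r s a ↦ by
            change algebraMap R A (r * s) * a = algebraMap R A r * (algebraMap R A s * a)
            rw [map_mul, mul_assoc] } }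
  map {A B} f := Mod.Hom.mk' (RingCat.ofHom f.hom.toRingHom) <| tensor_hom_ext fun r a ↦ by
    change f.hom (algebraMap R A r * a) = algebraMap R B r * f.hom a
    rw [map_mul, AlgHom.commutes]

instance : (modOfAlg R).Faithful where
  map_injective {A B f g} h := by
    refine AlgCat.hom_ext _ (AlgHom.ext fun a ↦ ?_)
    have h' : f.hom.toRingHom = g.hom.toRingHom :=
      congrArg (fun k ↦ RingCat.Hom.hom (Mod.Hom.hom k)) h
    exact DFunLike.congr_fun h' a

theorem modHom_smul {M N : Mod RingCat.{u} (RingCat.of R)} (f : M ⟶ N) (r : R) (m : M.X) :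
    f.hom.hom ((ModObj.smul (M := RingCat.of R) (X := M.X)).hom (r ⊗ₜ[ℤ] m)) =
      (ModObj.smul (M := RingCat.of R) (X := N.X)).hom (r ⊗ₜ[ℤ] f.hom.hom m) :=
  congr($(IsModHom.smul_hom (A := RingCat.of R) (f := f.hom)).hom (r ⊗ₜ[ℤ] m))

instance : (modOfAlg R).Full where
  map_surjective {A B} f := by
    refine ⟨AlgCat.ofHom { f.hom.hom with commutes' := fun r ↦ ?_ }, rfl⟩
    let φ : A →+* B := f.hom.hom
    have h : φ (algebraMap R A r * 1) = algebraMap R B r * φ 1 := modHom_smul R f r (1 : A)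
    rwa [mul_one, map_one, mul_one] at h

instance : (modOfAlg R).EssSurj where
  mem_essImage M := by
    let g : R ⊗[ℤ] M.X →+* M.X := (ModObj.smul (M := RingCat.of R) (X := M.X)).hom
    have hg (a : M.X) : g (1 ⊗ₜ a) = a := by
      have h : g (((1 : ℤ) : R) ⊗ₜ a) = (1 : ℤ) • a :=
        congr($(ModObj.one_smul (M := RingCat.of R) M.X).hom ((ULift.up (1 : ℤ)) ⊗ₜ[ℤ] a))
      rwa [Int.cast_one, one_zsmul] at h
    let := algebraOfAction g hg
    have h : RingCat.ofHom (actionHom R M.X) = ModObj.smul (M := RingCat.of R) (X := M.X) :=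
      RingCat.hom_ext (actionHom_algebraOfAction g hg)
    exact ⟨AlgCat.of R M.X, ⟨Mod.isoOfIso (Iso.refl M.X) (by
      change RingCat.ofHom (actionHom R M.X) ≫ 𝟙 M.X = RingCat.of R ◁ 𝟙 M.X ≫ _
      rw [MonoidalCategory.whiskerLeft_id, Category.id_comp]
      exact (Category.comp_id _).trans h)⟩⟩

end RingCat

namespace CatAb

/-! ### Functors between one-object categories -/

/-- The ring homomorphism given by an additive functor between one-object categories. -/
def OneObj.ringHom {A B : Type u} [Ring A] [Ring B] (F : OneObj A ⥤+ OneObj B) : A →+* B where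
  toFun a := F.obj.map (X := ⟨⟩) (Y := ⟨⟩) a
  map_one' := F.obj.map_id ⟨⟩
  map_mul' a b := F.obj.map_comp (X := ⟨⟩) (Y := ⟨⟩) (Z := ⟨⟩) a b
  map_zero' := haveI := F.property; F.obj.map_zero ⟨⟩ ⟨⟩
  map_add' a b := haveI := F.property; F.obj.map_add (X := ⟨⟩) (Y := ⟨⟩) (f := a) (g := b)

instance : underline.{u}.Full where
  map_surjective F := ⟨RingCat.ofHom (OneObj.ringHom F), rfl⟩

instance : underline.{u}.Faithful where
  map_injective {A _ _ _} h := RingCat.hom_ext <| RingHom.ext fun (a : A) ↦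
    eq_of_heq (Functor.hcongr_hom (congrArg fn h) (OneObj.arrow ⟨⟩ ⟨⟩ a))

/-- An additive functor `A̲ ⊗ B̲ ⥤ C̲` comes from a ring homomorphism `A ⊗ B → C`. -/
theorem OneObj.ofTensor_surjective {A B C : Type u} [Ring A] [Ring B] [Ring C] :
    Function.Surjective (OneObj.ofTensor : (A ⊗[ℤ] B →+* C) → _) := fun F ↦
  ⟨OneObj.ringHom (AdditiveFunctor.of ((OneObj.toTensor A B).obj ⋙ F.obj)),
    TensorObj.hext (fun _ _ ↦ rfl) fun _ _ _ _ _ _ ↦ HEq.rfl⟩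

/-- The one-object category of a ring as an object of `Ring̲`. -/
abbrev ofRing (A : Type u) [Ring A] : URing.{u} :=
  ⟨underline.obj (RingCat.of A), underline.obj_mem_essImage _⟩

theorem exists_iso_ofRing (X : URing.{u}) :
    ∃ (A : RingCat.{u}), Nonempty (ofRing A ≅ X) := by
  obtain ⟨A, ⟨e⟩⟩ := X.property
  exact ⟨A, ⟨ObjectProperty.isoMk _ e⟩⟩

/-- The morphism of one-object categories given by a ring homomorphism. -/
abbrev ofRingHom {A B : Type u} [Ring A] [Ring B] (f : A →+* B) : ofRing A ⟶ ofRing B :=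
  ObjectProperty.homMk (underline.map (RingCat.ofHom f))

theorem ofRingHom_injective {A B : Type u} [Ring A] [Ring B] :
    Function.Injective (ofRingHom : (A →+* B) → _) := fun f g h ↦
  congrArg RingCat.Hom.hom (underline.map_injective (X := RingCat.of A) (Y := RingCat.of B)
    (a₁ := RingCat.ofHom f) (a₂ := RingCat.ofHom g) (congrArg (fun k ↦ k.hom) h))

theorem ofRingHom_surjective {A B : Type u} [Ring A] [Ring B] :
    Function.Surjective (ofRingHom : (A →+* B) → _) := fun f ↦ ⟨OneObj.ringHom f.hom, rfl⟩

/-- The morphism `A̲ ⊗ B̲ ⟶ C̲` of `Ring̲` given by a ring homomorphism `A ⊗ B → C`. -/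
noncomputable abbrev ofTensorHom {A B C : Type u} [Ring A] [Ring B] [Ring C]
    (φ : A ⊗[ℤ] B →+* C) : ofRing A ⊗ ofRing B ⟶ ofRing C :=
  ObjectProperty.homMk (OneObj.ofTensor φ)

theorem ofTensorHom_surjective {A B C : Type u} [Ring A] [Ring B] [Ring C] :
    Function.Surjective (ofTensorHom : (A ⊗[ℤ] B →+* C) → _) := fun F ↦ by
  obtain ⟨φ, hφ⟩ := OneObj.ofTensor_surjective F.hom
  exact ⟨φ, ObjectProperty.hom_ext _ hφ⟩

/-- Evaluation of an equality of morphisms at `a ⊗ b`; the endpoints of the two arrows agree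
definitionally because `C̲` has a single object. -/
theorem map_tmul_of_eq {A B C : Type u} [Ring A] [Ring B] [Ring C]
    {F G : ofRing A ⊗ ofRing B ⟶ ofRing C} (h : F = G) (a : A) (b : B) :
    (fn F.hom).map (tmul (OneObj.arrow ⟨⟩ ⟨⟩ a) (OneObj.arrow ⟨⟩ ⟨⟩ b)) =
      (fn G.hom).map (tmul (OneObj.arrow ⟨⟩ ⟨⟩ a) (OneObj.arrow ⟨⟩ ⟨⟩ b)) :=
  eq_of_heq (Functor.hcongr_hom (congrArg (fun F ↦ fn F.hom) h) _)

/-! ### Modules over `R̲` in `Ring̲` -/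

variable (R : Type u) [CommRing R]

/-- The one-object category of an `R`-algebra as a module over `R̲`. -/
noncomputable def modOfAlg : AlgCat.{u} R ⥤ Mod URing.{u} (uring R) where
  obj A :=
    { X := ofRing A
      mod :=
        { smul := ofTensorHom (RingCat.actionHom R A)
          one_smul := ObjectProperty.hom_ext _ <| TensorObj.hext (fun _ _ ↦ rfl)
            fun _ _ _ _ (n : ULift.{u} ℤ) (a : A) ↦ heq_of_eq <| by
              change algebraMap R A ((n.down : ℤ) : R) * a = n.down • a
              rw [map_intCast, zsmul_eq_mul]
          mul_smul := ObjectProperty.hom_ext _ <| TensorObj.hext₃ (fun _ _ _ ↦ rfl)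
            fun _ _ _ _ _ _ (r : R) (s : R) (a : A) ↦ heq_of_eq <| by
              change algebraMap R A (r * s) * a = algebraMap R A r * (algebraMap R A s * a)
              rw [map_mul, mul_assoc] } }
  map {A B} f := Mod.Hom.mk' (ofRingHom f.hom.toRingHom) <| ObjectProperty.hom_ext _ <|
    TensorObj.hext (fun _ _ ↦ rfl) fun _ _ _ _ (r : R) (a : A) ↦ heq_of_eq <| by
      change f.hom (algebraMap R A r * a) = algebraMap R B r * f.hom a
      rw [map_mul, AlgHom.commutes]

instance : (modOfAlg R).Faithful where
  map_injective {A B f g} h := by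
    refine AlgCat.hom_ext _ (AlgHom.ext fun a ↦ ?_)
    exact DFunLike.congr_fun (ofRingHom_injective (congrArg Mod.Hom.hom h)) a

instance : (modOfAlg R).Full where
  map_surjective {A B} f := by
    obtain ⟨φ, hφ⟩ := ofRingHom_surjective (A := A) (B := B) f.hom
    have h (r : R) : φ (algebraMap R A r * 1) = algebraMap R B r * φ 1 := by
      have h := IsModHom.smul_hom (A := uring R) (f := f.hom)
      rw [← hφ] at h
      exact map_tmul_of_eq (A := R) (B := A) (C := B) h r 1
    refine ⟨AlgCat.ofHom { φ with commutes' := fun r ↦ ?_ }, Mod.hom_ext _ _ hφ⟩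
    have h := h r
    rwa [mul_one, map_one, mul_one] at h

instance : (modOfAlg R).EssSurj where
  mem_essImage M := by
    obtain ⟨A, ⟨e⟩⟩ := exists_iso_ofRing M.X
    have : IsMonHom (Iso.refl (uring R)).hom := inferInstanceAs (IsMonHom (𝟙 _))
    -- The action is transported to `A̲`, where it is given by a ring homomorphism `R ⊗ A → A`.
    let inst : ModObj (uring R) (ofRing A) := ModObj.ofIso (Iso.refl _) e.symm
    obtain ⟨g, hg⟩ := ofTensorHom_surjective (A := R) (B := A) (C := A) inst.smul
    have hg₁ (a : A) : g (1 ⊗ₜ a) = a := by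
      have h := inst.one_smul
      rw [← hg] at h
      have h : g (((1 : ℤ) : R) ⊗ₜ a) = (1 : ℤ) • a :=
        map_tmul_of_eq (A := ULift.{u} ℤ) (B := A) (C := A) h (ULift.up (1 : ℤ)) a
      rwa [Int.cast_one, one_zsmul] at h
    let := RingCat.algebraOfAction g hg₁
    refine ⟨AlgCat.of R A, ⟨Mod.isoOfIso e ?_⟩⟩
    change ofTensorHom (RingCat.actionHom R A) ≫ e.hom = uring R ◁ e.hom ≫ _
    rw [RingCat.actionHom_algebraOfAction, hg]
    change (((𝟙 _) ⊗ₘ e.hom) ≫ _ ≫ e.inv) ≫ e.hom = _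
    simp

end CatAb

namespace VCat

/-! ### Isomorphisms of enriched functors -/

section

variable {V : Type v} [Category.{w} V] [MonoidalCategory V]

/-- An isomorphism of `V`-functors on the one-object `V`-category of a monoid is an invertible
arrow between their values that is natural; the inverse is natural automatically. -/
def isoOfInverse {M : V} [MonObj M] {D : Type*} [EnrichedCategory V D]
    (F G : Fun V (Deloop M) D)
    (f : 𝟙_ V ⟶ (F.functor.obj ⟨⟩ ⟶[V] G.functor.obj ⟨⟩))
    (g : 𝟙_ V ⟶ (G.functor.obj ⟨⟩ ⟶[V] F.functor.obj ⟨⟩))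
    (hfg : compArrow V f g = eId V _) (hgf : compArrow V g f = eId V _)
    (hf : F.functor.map ⟨⟩ ⟨⟩ ≫ post V f (F.functor.obj ⟨⟩) =
      G.functor.map ⟨⟩ ⟨⟩ ≫ pre V f (G.functor.obj ⟨⟩)) : F ≅ G where
  hom := { app := fun _ ↦ f, naturality := fun _ _ ↦ hf }
  inv :=
    { app := fun _ ↦ g
      naturality := fun _ _ ↦ by
        change G.functor.map ⟨⟩ ⟨⟩ ≫ post V g (G.functor.obj ⟨⟩) =
          F.functor.map ⟨⟩ ⟨⟩ ≫ pre V g (F.functor.obj ⟨⟩)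
        calc
          _ = G.functor.map ⟨⟩ ⟨⟩ ≫ pre V (compArrow V g f) (G.functor.obj ⟨⟩) ≫
              post V g (G.functor.obj ⟨⟩) := by rw [hgf, pre_id, Category.id_comp]
          _ = (G.functor.map ⟨⟩ ⟨⟩ ≫ pre V f (G.functor.obj ⟨⟩)) ≫
              post V g (F.functor.obj ⟨⟩) ≫ pre V g (F.functor.obj ⟨⟩) := by
            simp only [pre_comp, Category.assoc, pre_post]
          _ = F.functor.map ⟨⟩ ⟨⟩ ≫ post V (compArrow V f g) (F.functor.obj ⟨⟩) ≫
              pre V g (F.functor.obj ⟨⟩) := by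
            rw [← hf, post_comp, Category.assoc, Category.assoc]
          _ = _ := by rw [hfg, post_id, Category.id_comp] }
  hom_inv_id := NatTrans.ext <| funext fun _ ↦ hfg
  inv_hom_id := NatTrans.ext <| funext fun _ ↦ hgf

/-- An isomorphism between the values that commutes with the actions is an isomorphism of
`V`-functors to `V`. -/
def FunToSelf.isoOfIso {M : V} [MonObj M] {F G : FunToSelf V (Deloop M)}
    (e : F.obj ⟨⟩ ≅ G.obj ⟨⟩) (h : F.act ⟨⟩ ⟨⟩ ≫ e.hom = e.hom ▷ M ≫ G.act ⟨⟩ ⟨⟩) : F ≅ G where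
  hom := { app := fun _ ↦ e.hom, naturality := fun _ _ ↦ h }
  inv :=
    { app := fun _ ↦ e.inv
      naturality := fun _ _ ↦ by
        change G.act ⟨⟩ ⟨⟩ ≫ e.inv = e.inv ▷ M ≫ F.act ⟨⟩ ⟨⟩
        rw [Iso.comp_inv_eq, Category.assoc, h, inv_hom_whiskerRight_assoc] }
  hom_inv_id := FunToSelf.Hom.ext <| funext fun _ ↦ e.hom_inv_id
  inv_hom_id := FunToSelf.Hom.ext <| funext fun _ ↦ e.inv_hom_id

/-- Transport of a `V`-functor to `V` along an isomorphism of its value. -/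
def FunToSelf.transport {M : V} [MonObj M] (F : FunToSelf V (Deloop M)) {X : V}
    (e : X ≅ F.obj ⟨⟩) : FunToSelf V (Deloop M) where
  obj _ := X
  act _ _ := e.hom ▷ M ≫ F.act ⟨⟩ ⟨⟩ ≫ e.inv
  act_id _ := by
    have h : (ρ_ (F.obj ⟨⟩)).inv ≫ F.obj ⟨⟩ ◁ MonObj.one ≫ F.act ⟨⟩ ⟨⟩ = 𝟙 _ := F.act_id ⟨⟩
    change (ρ_ X).inv ≫ X ◁ MonObj.one ≫ e.hom ▷ M ≫ F.act ⟨⟩ ⟨⟩ ≫ e.inv = 𝟙 X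
    rw [whisker_exchange_assoc, ← rightUnitor_inv_naturality_assoc, reassoc_of% h, e.hom_inv_id]
  act_comp _ _ _ := by
    have h : (α_ (F.obj ⟨⟩) M M).hom ≫ F.obj ⟨⟩ ◁ MonObj.mul ≫ F.act ⟨⟩ ⟨⟩ =
      F.act ⟨⟩ ⟨⟩ ▷ M ≫ F.act ⟨⟩ ⟨⟩ := F.act_comp ⟨⟩ ⟨⟩ ⟨⟩
    change (α_ X M M).hom ≫ X ◁ MonObj.mul ≫ e.hom ▷ M ≫ F.act ⟨⟩ ⟨⟩ ≫ e.inv =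
      (e.hom ▷ M ≫ F.act ⟨⟩ ⟨⟩ ≫ e.inv) ▷ M ≫ e.hom ▷ M ≫ F.act ⟨⟩ ⟨⟩ ≫ e.inv
    simp [whisker_exchange_assoc, ← reassoc_of% h]

end

end VCat

namespace CatAb

/-! ### Enriched functors from the one-object `Ring̲`-category of `R` to `Ring̲` -/

variable (R : Type u) [CommRing R]

/-- An `R`-algebra as an enriched functor to `Ring̲`, by the action `a ⊗ r ↦ r • a`. This is a right
action, as the transposes have the hom-object on the right; it is associative because `R` is
commutative. -/
noncomputable def funToSelfOfAlg :
    AlgCat.{u} R ⥤ VCat.FunToSelf URing.{u} (VCat.Deloop (uring R)) where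
  obj A :=
    { obj := fun _ ↦ ofRing A
      act := fun _ _ ↦ ofTensorHom ((RingCat.actionHom R A).comp
        (Algebra.TensorProduct.comm ℤ A R).toRingEquiv.toRingHom)
      act_id := fun _ ↦ ObjectProperty.hom_ext _ <| hom_hext (fun _ ↦ rfl)
        fun _ _ (a : A) ↦ heq_of_eq <| by
          change algebraMap R A ((1 : ℤ) : R) * a = a
          rw [Int.cast_one, map_one, one_mul]
      act_comp := fun _ _ _ ↦ ObjectProperty.hom_ext _ <| TensorObj.hext₃ (fun _ _ _ ↦ rfl)
        fun _ _ _ _ _ _ (a : A) (r : R) (s : R) ↦ heq_of_eq <| by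
          change algebraMap R A (r * s) * a = algebraMap R A s * (algebraMap R A r * a)
          rw [mul_comm, map_mul, mul_assoc] }
  map {A B} f :=
    { app := fun _ ↦ ofRingHom f.hom.toRingHom
      naturality := fun _ _ ↦ ObjectProperty.hom_ext _ <|
        TensorObj.hext (fun _ _ ↦ rfl) fun _ _ _ _ (a : A) (r : R) ↦ heq_of_eq <| by
          change f.hom (algebraMap R A r * a) = algebraMap R B r * f.hom a
          rw [map_mul, AlgHom.commutes] }

instance : (funToSelfOfAlg R).Faithful where
  map_injective {A B f g} h := by
    refine AlgCat.hom_ext _ (AlgHom.ext fun a ↦ ?_)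
    exact DFunLike.congr_fun (ofRingHom_injective
      (congrFun (congrArg VCat.FunToSelf.Hom.app h) ⟨⟩)) a

instance : (funToSelfOfAlg R).Full where
  map_surjective {A B} f := by
    obtain ⟨φ, hφ⟩ := ofRingHom_surjective (A := A) (B := B) (f.app ⟨⟩)
    have h (r : R) : φ (algebraMap R A r * 1) = algebraMap R B r * φ 1 := by
      have h := f.naturality ⟨⟩ ⟨⟩
      rw [← hφ] at h
      exact map_tmul_of_eq (A := A) (B := R) (C := B) h 1 r
    refine ⟨AlgCat.ofHom { φ with commutes' := fun r ↦ ?_ },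
      VCat.FunToSelf.Hom.ext (funext fun _ ↦ hφ)⟩
    have h := h r
    rwa [mul_one, map_one, mul_one] at h

instance : (funToSelfOfAlg R).EssSurj where
  mem_essImage F := by
    obtain ⟨A, ⟨e⟩⟩ := exists_iso_ofRing (F.obj ⟨⟩)
    -- The action on `A̲` is a ring homomorphism `A ⊗ R → A`; swapping the factors gives a left action.
    obtain ⟨g, hg⟩ := ofTensorHom_surjective (A := A) (B := R) (C := A)
      ((F.transport e).act ⟨⟩ ⟨⟩)
    let g' : R ⊗[ℤ] A →+* A := g.comp (Algebra.TensorProduct.comm ℤ R A).toRingEquiv.toRingHom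
    have hg₁ (a : A) : g' (1 ⊗ₜ a) = a := by
      have h := (F.transport e).act_id ⟨⟩
      rw [← hg] at h
      have h : g (a ⊗ₜ ((1 : ℤ) : R)) = a :=
        eq_of_heq (Functor.hcongr_hom (congrArg (fun F ↦ fn F.hom) h) (OneObj.arrow (A := A) ⟨⟩ ⟨⟩ a))
      rwa [Int.cast_one] at h
    let := RingCat.algebraOfAction g' hg₁
    refine ⟨AlgCat.of R A, ⟨VCat.FunToSelf.isoOfIso e ?_⟩⟩
    change ofTensorHom ((RingCat.actionHom R A).comp
      (Algebra.TensorProduct.comm ℤ A R).toRingEquiv.toRingHom) ≫ e.hom = e.hom ▷ uring R ≫ _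
    have hg' : g'.comp (Algebra.TensorProduct.comm ℤ A R).toRingEquiv.toRingHom = g :=
      RingCat.tensor_ringHom_ext fun _ _ ↦ rfl
    rw [RingCat.actionHom_algebraOfAction, hg', hg]
    change (e.hom ▷ _ ≫ _ ≫ e.inv) ≫ e.hom = _
    simp

end CatAb

namespace CatAb

/-! ### Arrows of the `Cat(Ab)`-category `Ring̲` -/

/-- A morphism from the unit of `Cat(Ab)` is determined by the object that it picks out. -/
theorem hom_unit_ext {D : CatAb.{u}} {F G : 𝟙_ CatAb.{u} ⟶ D}
    (h : (fn F).obj ⟨⟩ = (fn G).obj ⟨⟩) : F = G := by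
  have key (F : 𝟙_ CatAb.{u} ⟶ D) : F = pick ((fn F).obj ⟨⟩) :=
    hom_hext (fun _ ↦ rfl) fun X Y (n : ULift.{u} ℤ) ↦ heq_of_eq <| by
      have hn : OneObj.arrow X Y n = n.down • OneObj.arrow X Y 1 :=
        ULift.ext _ _ (mul_one n.down).symm
      change (fn F).map (OneObj.arrow X Y n) = _
      rw [hn, Functor.map_zsmul]
      exact congrArg (n.down • ·) ((fn F).map_id _)
  rw [key F, key G, h]

/-- Arrows of functor categories are heterogeneously equal if their endpoints agree and their
components are. -/
theorem natTrans_heq {C D : Type u} [Category.{u} C] [Preadditive C] [Category.{u} D]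
    [Preadditive D] {F F' G G' : C ⥤+ D} (hF : F = F') (hG : G = G')
    {α : F ⟶ G} {β : F' ⟶ G'} (h : ∀ X, HEq (α.hom.app X) (β.hom.app X)) : HEq α β := by
  subst hF hG
  exact heq_of_eq (ObjectProperty.hom_ext _ (NatTrans.ext (funext fun X ↦ eq_of_heq (h X))))

/-- An additive functor between objects of `Ring̲` as an arrow of the `Cat(Ab)`-category `Ring̲`. -/
abbrev arrowOfFun {X Y : URing.{u}} (G : X.obj ⟶ Y.obj) : 𝟙_ CatAb.{u} ⟶ (X ⟶[CatAb.{u}] Y) :=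
  pick (D := X.obj ⥤+ Y.obj) G

/-- Postcomposition with an additive functor is whiskering on arrows. -/
theorem post_arrowOfFun_app {X Y Z : URing.{u}} (G : X.obj ⟶ Y.obj) {F F' : Z.obj ⥤+ X.obj}
    (α : F ⟶ F') (z : Z.obj) :
    ((fn (VCat.post CatAb.{u} (arrowOfFun G) Z)).map α).hom.app z = (fn G).map (α.hom.app z) := by
  change ((1 : ℤ) • 𝟙 ((fn G).obj (F.obj.obj z))) ≫ (fn G).map (α.hom.app z) = _
  rw [one_zsmul, Category.id_comp]

/-- Precomposition with an additive functor is whiskering on arrows. -/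
theorem pre_arrowOfFun_app {X Y Z : URing.{u}} (G : X.obj ⟶ Y.obj) {F F' : Y.obj ⥤+ Z.obj}
    (α : F ⟶ F') (x : X.obj) :
    ((fn (VCat.pre CatAb.{u} (arrowOfFun G) Z)).map α).hom.app x = α.hom.app ((fn G).obj x) := by
  change α.hom.app _ ≫ F'.obj.map ((1 : ℤ) • 𝟙 ((fn G).obj x)) = _
  rw [one_zsmul, CategoryTheory.Functor.map_id, Category.comp_id]

/-! ### Enriched functors from the one-object `Cat(Ab)`-category of `R` to `Ring̲` -/

section

variable (R : Type u) [CommRing R] (A : Type u) [Ring A]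

/-- The action of `R` on an `R`-algebra `A`, as a functor to the endofunctors of `A̲`: the scalars
are central in `A`, so they are endomorphisms of the identity functor. -/
def scalarFunctor [Algebra R A] : OneObj R ⥤+ (OneObj A ⥤+ OneObj A) where
  obj :=
    { obj := fun _ ↦ AdditiveFunctor.of (𝟭 (OneObj A))
      map := fun (r : R) ↦ ObjectProperty.homMk
        { app := fun _ ↦ algebraMap R A r
          naturality := fun _ _ (a : A) ↦ (Algebra.commutes r a).symm }
      map_id := fun _ ↦ ObjectProperty.hom_ext _ <| NatTrans.ext <| funext fun _ ↦
        map_one (algebraMap R A)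
      map_comp := fun (r s : R) ↦ ObjectProperty.hom_ext _ <| NatTrans.ext <| funext fun _ ↦
        map_mul (algebraMap R A) r s }
  property := ⟨fun {_ _} {r s : R} ↦ ObjectProperty.hom_ext _ <| NatTrans.ext <| funext fun _ ↦
    map_add (algebraMap R A) r s⟩

/-- Compatibility of the action with composition. Horizontal composition of endomorphisms of the
identity functor of `A̲` multiplies the scalars in the opposite order, and they commute. -/
theorem scalarFunctor_comp [Algebra R A] (r s : R) :
    (scalarFunctor R A).obj.map (OneObj.arrow ⟨⟩ ⟨⟩ (r * s)) =
      (compFun (OneObj A) (OneObj A) (OneObj A)).obj.map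
        (tmul ((scalarFunctor R A).obj.map (OneObj.arrow ⟨⟩ ⟨⟩ r))
          ((scalarFunctor R A).obj.map (OneObj.arrow ⟨⟩ ⟨⟩ s))) :=
  ObjectProperty.hom_ext _ <| NatTrans.ext <| funext fun _ ↦ by
    change algebraMap R A (r * s) = algebraMap R A s * algebraMap R A r
    rw [mul_comm, map_mul]

variable {R A} {X : Type u} [Category.{u} X] [Preadditive X] (E : OneObj A ⥤+ X)
  (E' : X ⥤+ OneObj A) (T : OneObj R ⥤+ (X ⥤+ X))

/-- The scalars in `A` given by a functor from `R̲` to the endofunctors of a category `X` and by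
functors `A̲ ⥤ X` and `X ⥤ A̲`: the images in `A̲` of the components, at the object of `X` that
comes from `A̲`, of the natural transformations. -/
def scalarHom : R →+* A where
  toFun r := E'.obj.map ((T.obj.map (OneObj.arrow ⟨⟩ ⟨⟩ r)).hom.app (E.obj.obj ⟨⟩))
  map_one' := by
    change E'.obj.map ((T.obj.map (𝟙 (⟨⟩ : OneObj R))).hom.app _) = _
    rw [CategoryTheory.Functor.map_id]
    exact E'.obj.map_id _
  map_mul' r s := by
    change E'.obj.map ((T.obj.map (OneObj.arrow ⟨⟩ ⟨⟩ r ≫ OneObj.arrow ⟨⟩ ⟨⟩ s)).hom.app _) = _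
    rw [Functor.map_comp]
    exact E'.obj.map_comp _ _
  map_zero' := by
    change E'.obj.map ((T.obj.map (0 : (⟨⟩ : OneObj R) ⟶ ⟨⟩)).hom.app _) = _
    rw [Functor.map_zero]
    exact E'.obj.map_zero _ _
  map_add' r s := by
    change E'.obj.map ((T.obj.map (OneObj.arrow ⟨⟩ ⟨⟩ r + OneObj.arrow ⟨⟩ ⟨⟩ s)).hom.app _) = _
    rw [Functor.map_add]
    exact E'.obj.map_add

/-- The scalars are central: apply naturality to the arrows that come from `A̲`. -/
theorem scalarHom_commutes (hE : E.obj ⋙ E'.obj = 𝟭 _)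
    (hT : T.obj.obj ⟨⟩ = AdditiveFunctor.of (𝟭 X)) (r : R) (a : A) :
    scalarHom E E' T r * a = a * scalarHom E E' T r := by
  let S : X ⥤+ X := T.obj.obj ⟨⟩
  let τ : S ⟶ S := T.obj.map (OneObj.arrow ⟨⟩ ⟨⟩ r)
  let f := E.obj.map (OneObj.arrow (A := A) ⟨⟩ ⟨⟩ a)
  have hS : E.obj ⋙ S.obj ⋙ E'.obj = 𝟭 _ := by
    change E.obj ⋙ (T.obj.obj ⟨⟩).obj ⋙ E'.obj = 𝟭 _
    rw [hT]
    exact hE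
  have ha : E'.obj.map (S.obj.map f) = OneObj.arrow (A := A)
      (E'.obj.obj (S.obj.obj (E.obj.obj ⟨⟩))) (E'.obj.obj (S.obj.obj (E.obj.obj ⟨⟩))) a :=
    eq_of_heq (Functor.hcongr_hom hS _)
  have h := congrArg E'.obj.map (τ.hom.naturality f)
  rw [Functor.map_comp, Functor.map_comp, ha] at h
  exact h.symm

/-- An isomorphism `A̲ ≅ C` carries the action of the scalars `scalarHom` on `A̲` to the given
action `T` on `C`. -/
theorem scalarFunctor_post (C : URing.{u}) (e : underline.obj (RingCat.of A) ≅ C.obj)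
    (T : OneObj R ⥤+ (C.obj ⥤+ C.obj)) (hT : T.obj.obj ⟨⟩ = AdditiveFunctor.of (𝟭 C.obj)) :
    letI := (scalarHom e.hom e.inv T).toAlgebra'
      (scalarHom_commutes e.hom e.inv T (congrArg fn e.hom_inv_id) hT)
    CategoryStruct.comp (obj := CatAb.{u}) (X := ⟨OneObj R⟩)
      (Y := ihom (ofRing A).obj (ofRing A).obj) (scalarFunctor R A)
      (VCat.post CatAb.{u} (arrowOfFun (X := ofRing A) (Y := C) e.hom) (ofRing A)) =
    CategoryStruct.comp (obj := CatAb.{u}) (X := ⟨OneObj R⟩) (Y := ihom C.obj C.obj) T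
      (VCat.pre CatAb.{u} (arrowOfFun (X := ofRing A) (Y := C) e.hom) C) := by
  let := (scalarHom e.hom e.inv T).toAlgebra'
      (scalarHom_commutes e.hom e.inv T (congrArg fn e.hom_inv_id) hT)
  let E : OneObj A ⥤+ C.obj := e.hom
  -- `T` takes its object to the identity functor only propositionally, so the endpoints of the
  -- natural transformations to be compared are not definitionally equal.
  have hobj (x : OneObj R) : AdditiveFunctor.of (𝟭 (OneObj A) ⋙ E.obj) =
      AdditiveFunctor.of (E.obj ⋙ (T.obj.obj x).obj) := by
    change _ = AdditiveFunctor.of (E.obj ⋙ (T.obj.obj ⟨⟩).obj)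
    rw [hT]
    rfl
  refine hom_hext hobj fun x y (r : R) ↦ natTrans_heq (hobj x) (hobj y) fun a ↦ ?_
  refine (heq_of_eq (post_arrowOfFun_app (X := ofRing A) (Y := C) (Z := ofRing A) e.hom
    ((scalarFunctor R A).obj.map (OneObj.arrow x y r)) a)).trans
    (HEq.trans ?_ (heq_of_eq (pre_arrowOfFun_app (X := ofRing A) (Y := C) (Z := C) e.hom
      (T.obj.map (OneObj.arrow x y r)) a)).symm)
  exact Functor.hcongr_hom (congrArg fn e.inv_hom_id)
    ((T.obj.map (OneObj.arrow ⟨⟩ ⟨⟩ r)).hom.app (E.obj.obj ⟨⟩))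

end

variable (R : Type u) [CommRing R]

/-- Naturality of the enriched transformation given by an algebra homomorphism `f`; on the arrow
`r` it says that `f` preserves the scalar `r`. -/
theorem scalarFunctor_natural {A B : Type u} [Ring A] [Algebra R A] [Ring B] [Algebra R B]
    (f : A →ₐ[R] B) :
    CategoryStruct.comp (obj := CatAb.{u}) (X := ⟨OneObj R⟩)
      (Y := ihom (ofRing A).obj (ofRing A).obj) (scalarFunctor R A)
      (VCat.post CatAb.{u} (arrowOfFun (X := ofRing A) (Y := ofRing B)
        (underline.map (RingCat.ofHom f.toRingHom))) (ofRing A)) =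
    CategoryStruct.comp (obj := CatAb.{u}) (X := ⟨OneObj R⟩)
      (Y := ihom (ofRing B).obj (ofRing B).obj) (scalarFunctor R B)
      (VCat.pre CatAb.{u} (arrowOfFun (X := ofRing A) (Y := ofRing B)
        (underline.map (RingCat.ofHom f.toRingHom))) (ofRing B)) := by
  refine hom_hext (fun _ ↦ rfl) fun x y (r : R) ↦ heq_of_eq <|
    ObjectProperty.hom_ext _ (NatTrans.ext (funext fun a ↦ ?_))
  refine (post_arrowOfFun_app (X := ofRing A) (Y := ofRing B) (Z := ofRing A)
    (underline.map (RingCat.ofHom f.toRingHom))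
    ((scalarFunctor R A).obj.map (OneObj.arrow x y r)) a).trans (Eq.trans ?_
    (pre_arrowOfFun_app (X := ofRing A) (Y := ofRing B) (Z := ofRing B)
      (underline.map (RingCat.ofHom f.toRingHom))
      ((scalarFunctor R B).obj.map (OneObj.arrow x y r)) a).symm)
  exact f.commutes r

/-- An `R`-algebra as a `Cat(Ab)`-enriched functor to `Ring̲`. -/
noncomputable def funOfAlg : AlgCat.{u} R ⥤
    VCat.Fun CatAb.{u} (VCat.Deloop (underline.obj (RingCat.of R))) URing.{u} where
  obj A :=
    { functor :=
        { obj := fun _ ↦ ofRing A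
          map := fun _ _ ↦ scalarFunctor R A
          map_id := fun _ ↦ hom_unit_ext rfl
          map_comp := fun _ _ _ ↦ TensorObj.hext (fun _ _ ↦ rfl) fun _ _ _ _ r s ↦
            heq_of_eq (scalarFunctor_comp R A r s) } }
  map {A B} f :=
    { app := fun _ ↦ arrowOfFun (X := ofRing A) (Y := ofRing B)
        (underline.map (RingCat.ofHom f.hom.toRingHom))
      naturality := fun _ _ ↦ scalarFunctor_natural R f.hom }
  map_id A := VCat.NatTrans.ext <| funext fun _ ↦ hom_unit_ext (underline.map_id (RingCat.of A))
  map_comp {A B C} f g := VCat.NatTrans.ext <| funext fun _ ↦ hom_unit_ext <|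
    underline.map_comp (X := RingCat.of A) (Y := RingCat.of B) (Z := RingCat.of C)
      (RingCat.ofHom f.hom.toRingHom) (RingCat.ofHom g.hom.toRingHom)

instance : (funOfAlg R).Faithful where
  map_injective {A B f g} h := by
    refine AlgCat.hom_ext _ (AlgHom.ext fun a ↦ ?_)
    have h : underline.map (RingCat.ofHom f.hom.toRingHom) =
        underline.map (RingCat.ofHom g.hom.toRingHom) :=
      congrArg (fun k ↦ (fn (VCat.NatTrans.app k ⟨⟩)).obj ⟨⟩) h
    exact DFunLike.congr_fun (congrArg RingCat.Hom.hom (underline.map_injective h)) a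

instance : (funOfAlg R).Full where
  map_surjective {A B} α := by
    obtain ⟨φ, hφ⟩ := underline.map_surjective (X := RingCat.of A) (Y := RingCat.of B)
      ((fn (α.app ⟨⟩)).obj ⟨⟩)
    have hα : arrowOfFun (X := ofRing A) (Y := ofRing B) (underline.map φ) = α.app ⟨⟩ :=
      hom_unit_ext hφ
    refine ⟨AlgCat.ofHom { φ.hom with commutes' := fun r ↦ ?_ },
      VCat.NatTrans.ext (funext fun _ ↦ hα)⟩
    let φ' := underline.map φ
    have h := α.naturality ⟨⟩ ⟨⟩
    rw [← hα] at h
    -- Naturality on the arrow `r` says that `φ` preserves the scalar `r`.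
    have h₁ : (fn (VCat.post CatAb.{u} (arrowOfFun (X := ofRing A) (Y := ofRing B) φ')
        (ofRing A))).map ((scalarFunctor R A).obj.map (OneObj.arrow ⟨⟩ ⟨⟩ r)) =
      (fn (VCat.pre CatAb.{u} (arrowOfFun (X := ofRing A) (Y := ofRing B) φ')
        (ofRing B))).map ((scalarFunctor R B).obj.map (OneObj.arrow ⟨⟩ ⟨⟩ r)) :=
      eq_of_heq (Functor.hcongr_hom (congrArg fn h) (OneObj.arrow (A := R) ⟨⟩ ⟨⟩ r))
    exact (post_arrowOfFun_app (X := ofRing A) (Y := ofRing B) (Z := ofRing A) φ' _ ⟨⟩).symm.trans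
      ((congrArg (fun τ ↦ τ.hom.app (⟨⟩ : OneObj A)) h₁).trans
        (pre_arrowOfFun_app (X := ofRing A) (Y := ofRing B) (Z := ofRing B) φ' _ ⟨⟩))

instance : (funOfAlg R).EssSurj where
  mem_essImage F := by
    obtain ⟨A, ⟨e⟩⟩ := (F.functor.obj ⟨⟩).property
    let X := (F.functor.obj ⟨⟩).obj
    let T : OneObj R ⥤+ (X ⥤+ X) := F.functor.map ⟨⟩ ⟨⟩
    have hT : T.obj.obj ⟨⟩ = AdditiveFunctor.of (𝟭 X) :=
      congrArg (fun G : 𝟙_ CatAb.{u} ⟶ ihom X X ↦ (fn G).obj ⟨⟩) (F.functor.map_id ⟨⟩)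
    let := (scalarHom e.hom e.inv T).toAlgebra'
      (scalarHom_commutes e.hom e.inv T (congrArg fn e.hom_inv_id) hT)
    exact ⟨AlgCat.of R A, ⟨VCat.isoOfInverse _ _ (arrowOfFun e.hom) (arrowOfFun e.inv)
      (hom_unit_ext e.hom_inv_id) (hom_unit_ext e.inv_hom_id) (scalarFunctor_post _ e T hT)⟩⟩

end CatAb

theorem mainTheorem3 (R : Type u) [CommRing R] :
    Nonempty (Mod RingCat.{u} (RingCat.of R) ≌ Mod CatAb.URing.{u} (CatAb.uring R)) ∧
    Nonempty (Mod CatAb.URing.{u} (CatAb.uring R) ≌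
      VCat.Fun CatAb.{u} (VCat.Deloop (CatAb.underline.obj (RingCat.of R))) CatAb.URing.{u}) ∧
    Nonempty
      (VCat.Fun CatAb.{u} (VCat.Deloop (CatAb.underline.obj (RingCat.of R))) CatAb.URing.{u} ≌
        VCat.FunToSelf CatAb.URing.{u} (VCat.Deloop (CatAb.uring R))) := by
  have : (RingCat.modOfAlg R).IsEquivalence := {}
  have : (CatAb.modOfAlg R).IsEquivalence := {}
  have : (CatAb.funOfAlg R).IsEquivalence := {}
  have : (CatAb.funToSelfOfAlg R).IsEquivalence := {}
  exact ⟨⟨(RingCat.modOfAlg R).asEquivalence.symm.trans (CatAb.modOfAlg R).asEquivalence⟩,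
    ⟨(CatAb.modOfAlg R).asEquivalence.symm.trans (CatAb.funOfAlg R).asEquivalence⟩,
    ⟨(CatAb.funOfAlg R).asEquivalence.symm.trans (CatAb.funToSelfOfAlg R).asEquivalence⟩⟩
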